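/- **Setting.** Let $k$ be an algebraically closed field of characteristic $0$, $(R,\mathfrak m)$ a two-dimensional regular local ring containing $k$ whose fraction field $K$ is a finitely generated field extension of $k$ of transcendence degree $2$, let $\mathfrak m=(x,y)$, and let $\nu$ be a non-divisorial valuation of $K$ centered on $R$ (that is, $\nu\ge 0$ on $R$, and $\nu(f)>0$ for $f\in R$ exactly when $f\in\mathfrak m$). Put $\beta_0=\nu(x)$. **Blowups.** Let $(x_0,y_0)=(x,y)$. If $\nu(x_n)<\nu(y_n)$, put $x_n=x_{n+1}$, $y_n=x_{n+1}y_{n+1}$ ($x$-blowup); if $\nu(x_n)>\nu(y_n)$, put $x_n=x_{n+1}y_{n+1}$, $y_n=y_{n+1}$ ($y$-blowup); if $\nu(x_n)=\nu(y_n)$, put $x_n=x_{n+1}$, $y_n=x_{n+1}(y_{n+1}+c_n)$ with $0\ne c_n\in k$ the residue of $y_n/x_n$ ($z$-blowup). **Dual graph data.** The data are $g\in\{0,1,2,\dots,\infty\}$, numbers of segments $m_i$, and segment lengths $a_j^{(i)}$ ($i\ge1$, $1\le j\le m_i$); segment lengths are at least $1$, and they are finite unless stated otherwise. Put $\Sigma(i,s,t)=\sum_{l<i}\sum_{j=1}^{m_l}a_j^{(l)}+\sum_{j=1}^{s}a_j^{(i)}+t$.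 We suppose that, for each $i\le g$, the blowups performed at the levels from $\Sigma(i,0,0)$ on are $a_1^{(i)}$ $x$-blowups (for $i\ge2$: one $z$-blowup followed by $a_1^{(i)}-1$ $x$-blowups), then $a_2^{(i)}$ $y$-blowups, then $a_3^{(i)}$ $x$-blowups, and so on alternately, and that one of the following holds. * Type 1: $g=\infty$ and $2\le m_i<\infty$ for all $i$. Here $\nu$ is real-valued and $g'=\infty$. * Type 2: $1\le g<\infty$, $2\le m_i<\infty$ for $i<g$, and $m_g=\infty$. Here $\nu$ is real-valued with $\nu(x)=1$, and $g'=g$. * Type 3: $1\le g<\infty$, $2\le m_i<\infty$ for $i\le g$, and $a_{m_g}^{(g)}=\infty$. Here $\nu$ takes values in $\mathbb Q^2$ with the lexicographic order and is normalized so that at level $n=\Sigma(g,m_g-2,a_{m_g-1}^{(g)})$ one has $\nu(x_n)=(0,1)$, $\nu(y_n)=(1,0)$ if $m_g$ is odd, and $\nu(x_n)=(1,0)$, $\nu(y_n)=(0,1)$ if $m_g$ is even; $g'=g$. * Type 4.1: $g<\infty$, $2\le m_i<\infty$ for $i\le g$, and from level $\Sigma(g+1,0,0)$ on there are only $x$-blowups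 and $z$-blowups, with infinitely many $z$-blowups (the first blowup of this tail being a $z$-blowup if $g\ge1$). Here $\nu$ is real-valued and $g'=g$. * Type 4.2: $g<\infty$, $2\le m_i<\infty$ for $i\le g$, and from level $\Sigma(g+1,0,0)$ on there is one $z$-blowup (none if $g=0$) followed by infinitely many $x$-blowups. Here $\nu$ takes values in $\mathbb Q^2$ with the lexicographic order and is normalized so that $\nu(x)=(0,1)$ and the value group is $\mathbb Z\times\frac1{q_1\cdots q_g}\mathbb Z$, with $q_i$ as defined below; $g'=g+1$. Write $[a_1,\dots,a_n]=a_1+1/(a_2+1/(\cdots+1/a_n))$. Let $\beta_i'=[a_1^{(i)},\dots,a_{m_i}^{(i)},1]=p_i/q_i$ in lowest terms (for finite pieces), $q_0=1$, and let $\lambda_j^{(i)}/\mu_j^{(i)}=[a_1^{(i)},\dots,a_j^{(i)}]$ in lowest terms, with $\lambda_0^{(i)}=1$, $\mu_0^{(i)}=0$. Let $Y_i=y_{\Sigma(i,0,1)}$. **Generating sequence.** Let $\{Q_i\}_{0\le i\le g'}$ ($i<\infty$) be a minimal generating sequence for $\nu$ of the following form: $Q_0=x$, $Q_1=y$ and,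 for $i\ge2$, $Q_i=Q_{i-1}^{q_{i-1}}-\sum_{h=1}^{\delta_i}u_h^{(i)}\prod_{j=0}^{i-2}Q_j^{\gamma_{j,h}^{(i)}}$ with $\delta_i\ge1$, $0\ne u_h^{(i)}\in k$, $\gamma_{j,h}^{(i)}\in\mathbb Z_{\ge0}$ and $\sum_{j}\gamma_{j,h}^{(i)}\nu(Q_j)=q_{i-1}\nu(Q_{i-1})$ for all $h$. Here "generating" means that the values $\nu(Q_i)$ generate the value semigroup $\{\nu(f): 0\neq f\in\mathfrak m\}$, and "minimal" means that this fails when any one $Q_j$ is left out. **Lemma.** (a) For $2\le i<g'$ (so for all $i\ge2$ in Type 1), and also for $i=g'\ge 2$ in Type 4.1, $$\nu(Q_i)=q_{i-1}\nu(Q_{i-1})+\frac{1}{q_1\cdots q_{i-1}}(\beta_i'-1)\beta_0 .$$ (b) For Types 2, 3 and 4.2, $\nu(Q_{g'})=q_{g'-1}\nu(Q_{g'-1})+\nu(Y_{g'})$, where * Type 2: $\nu(Y_g)=\frac{1}{q_1\cdots q_{g-1}}(\tilde\beta_g-1)$, where $\tilde\beta_g=[a_1^{(g)},a_2^{(g)},\dots]=\lim_n[a_1^{(g)},\dots,a_n^{(g)}]$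 exists and is irrational; * Type 3: $\nu(Y_g)=\bigl(\lambda_{m-1}^{(g)}-\mu_{m-1}^{(g)},\ \lambda_{m-2}^{(g)}-\mu_{m-2}^{(g)}\bigr)$, where $m=m_g$; * Type 4.2: $\nu(Y_{g+1})=\bigl(1,\frac{n}{q_1\cdots q_g}\bigr)$ for some $n\in\mathbb Z$. (c) In Type 3, $\beta_0=q_1\cdots q_{g-1}\bigl(\mu_{m-1}^{(g)},\mu_{m-2}^{(g)}\bigr)$, where $m=m_g$. -/

import Mathlib

open IsLocalRing

/-! ### Continued fractions and the defining data of a dual graph -/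

/-- The finite continued fraction `[a₁, …, aₙ] = a₁ + 1 / (a₂ + 1 / (⋯ + 1 / aₙ))`. -/
def contFrac : List ℕ → ℚ
  | [] => 0
  | [a] => a
  | a :: b :: l => a + 1 / contFrac (b :: l)

/-- The defining set of data of a dual graph: `g` is the number of pieces having both an odd and an
even leg, `m i` is the number of segments of the `i`-th piece, and `a i j` is the number of vertices
in the `j`-th segment of the `i`-th piece. Pieces and segments are numbered from `1`; only the
entries with `1 ≤ i`, `1 ≤ j ≤ m i` that belong to an actual piece are meaningful. Infinite values
are allowed, as needed for non-divisorial valuations. -/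
structure DualGraphData where
  g : ℕ∞
  m : ℕ → ℕ∞
  a : ℕ → ℕ → ℕ∞

namespace DualGraphData

variable (d : DualGraphData)

/-- The number `g` of pieces as a natural number (used when it is finite). -/
def gNat : ℕ := d.g.toNat

/-- The number `m_i` of segments as a natural number (used when it is finite). -/
def numSeg (i : ℕ) : ℕ := (d.m i).toNat

/-- The entry `a_j^{(i)}` as a natural number (used when it is finite). -/
def entry (i j : ℕ) : ℕ := (d.a i j).toNat

/-- `Σ(i, s, t) = ∑_{k < i} ∑_{j ≤ m_k} a_j^{(k)} + ∑_{l ≤ s} a_l^{(i)} + t`, the label of the `t`-th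
vertex of the `(s+1)`-th segment of the `i`-th piece; `Σ(i, s, 0)` is the label just before that
segment. -/
def sigma (i s t : ℕ) : ℕ :=
  (∑ k ∈ Finset.Icc 1 (i - 1), ∑ j ∈ Finset.Icc 1 (d.numSeg k), d.entry k j)
    + (∑ l ∈ Finset.Icc 1 s, d.entry i l) + t

/-- The list `a_1^{(i)}, …, a_n^{(i)}`. -/
def entries (i n : ℕ) : List ℕ := (List.range n).map fun j => d.entry i (j + 1)

/-- The `j`-th convergent `[a_1^{(i)}, …, a_j^{(i)}]` (for `j ≥ 1`). -/
def convergent (i j : ℕ) : ℚ := contFrac (d.entries i j)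

/-- Numerator `λ_j^{(i)}` of the `j`-th convergent in lowest terms, with `λ_0 = 1`. -/
def lam (i j : ℕ) : ℚ := if j = 0 then 1 else (d.convergent i j).num

/-- Denominator `μ_j^{(i)}` of the `j`-th convergent in lowest terms, with `μ_0 = 0`. -/
def mu (i j : ℕ) : ℚ := if j = 0 then 0 else (d.convergent i j).den

/-- `β_i' = [a_1^{(i)}, …, a_{m_i}^{(i)}, 1]`. -/
def betaPrime (i : ℕ) : ℚ := contFrac (d.entries i (d.numSeg i) ++ [1])

/-- `q_i`, the denominator of `β_i' = p_i / q_i` in lowest terms, with `q_0 = 1`. -/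
def q (i : ℕ) : ℕ := if i = 0 then 1 else (d.betaPrime i).den

/-- The product `q_1 ⋯ q_i`. -/
def qProd (i : ℕ) : ℕ := ∏ j ∈ Finset.Icc 1 i, d.q j

/-- The `i`-th piece is finite, has both legs, and all its segments are nonempty. -/
structure FinitePiece (i : ℕ) : Prop where
  two_le : 2 ≤ d.m i
  m_ne_top : d.m i ≠ ⊤
  one_le : ∀ s : ℕ, 1 ≤ s → (s : ℕ∞) ≤ d.m i → 1 ≤ d.a i s
  a_ne_top : ∀ s : ℕ, 1 ≤ s → (s : ℕ∞) ≤ d.m i → d.a i s ≠ ⊤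

end DualGraphData

/-! ### Sequences of point blowups along a valuation -/

/-- The three kinds of transformations of regular parameters. -/
inductive BlowupKind
  | x
  | y
  | z

section Valuation

variable (k : Type*) (R : Type*) {K Γ : Type*} [Field k] [CommRing R] [IsLocalRing R] [Field K]
  [Algebra k R] [Algebra R K] [Algebra k K]
  [AddCommGroup Γ] [LinearOrder Γ] [IsOrderedAddMonoid Γ]

/-- `ν` is centered on `R`: `R` lies in the valuation ring of `ν` and the maximal ideal of `R` is the
contraction of the maximal ideal of the valuation ring. (As `k ⊆ R`, this forces `ν` to vanish on
the nonzero elements of `k`.) -/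
structure IsCenteredOn (ν : AddValuation K (WithTop Γ)) : Prop where
  nonneg : ∀ f : R, 0 ≤ ν (algebraMap R K f)
  pos_iff : ∀ f : R, 0 < ν (algebraMap R K f) ↔ f ∈ maximalIdeal R

/-- `P n = (x_n, y_n)`, `n ≥ 0`, are the parameters obtained from `(x, y)` by successively blowing up
along `ν`: an `x`-blowup if `ν(x_n) < ν(y_n)`, a `y`-blowup if `ν(x_n) > ν(y_n)`, and, if
`ν(x_n) = ν(y_n)`, a `z`-blowup `y_n = x_{n+1} (y_{n+1} + c_n)` with `0 ≠ c_n ∈ k` the residue of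
`y_n / x_n`. The sequence does not terminate (the valuation is non-divisorial). -/
structure IsBlowupSequence (ν : AddValuation K (WithTop Γ)) (x y : K) (P : ℕ → K × K) : Prop where
  init : P 0 = (x, y)
  x_blowup : ∀ n, ν (P n).1 < ν (P n).2 →
    (P n).1 = (P (n + 1)).1 ∧ (P n).2 = (P (n + 1)).1 * (P (n + 1)).2
  y_blowup : ∀ n, ν (P n).2 < ν (P n).1 →
    (P n).1 = (P (n + 1)).1 * (P (n + 1)).2 ∧ (P n).2 = (P (n + 1)).2
  z_blowup : ∀ n, ν (P n).1 = ν (P n).2 →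
    ∃ c : k, c ≠ 0 ∧ 0 < ν ((P n).2 / (P n).1 - algebraMap k K c) ∧
      (P n).1 = (P (n + 1)).1 ∧ (P n).2 = (P (n + 1)).1 * ((P (n + 1)).2 + algebraMap k K c)

/-- The kind of blowup performed on the parameters `p`. -/
def blowupKind (ν : AddValuation K (WithTop Γ)) (p : K × K) : BlowupKind :=
  if ν p.1 < ν p.2 then .x else if ν p.2 < ν p.1 then .y else .z

namespace DualGraphData

variable (d : DualGraphData)

/-- The kind of the `t`-th (`t = 0, 1, …`) blowup counted by the `s`-th segment of the `i`-th piece: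
even segments count `y`-blowups, odd segments count `x`-blowups, except that for `i ≥ 2` the first
blowup counted by the first segment is a `z`-blowup. -/
def expectedKind (i s t : ℕ) : BlowupKind :=
  if Even s then .y else if 2 ≤ i ∧ s = 1 ∧ t = 0 then .z else .x

/-- The blowups counted by the `i`-th piece of the dual graph are of the kinds which the data
prescribe. The vertex `Σ(i, s - 1, t + 1)` is created by blowing up at level `Σ(i, s - 1, t)`. -/
def RealizesPiece (ν : AddValuation K (WithTop Γ)) (P : ℕ → K × K) (i : ℕ) : Prop :=
  ∀ s : ℕ, 1 ≤ s → (s : ℕ∞) ≤ d.m i → ∀ t : ℕ, (t : ℕ∞) < d.a i s →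
    blowupKind ν (P (d.sigma i (s - 1) t)) = expectedKind i s t

/-- Type 1 (infinitely singular): infinitely many finite pieces. -/
structure IsType1 (ν : AddValuation K (WithTop Γ)) (P : ℕ → K × K) : Prop where
  g_eq : d.g = ⊤
  finitePiece : ∀ i, 1 ≤ i → d.FinitePiece i
  realizes : ∀ i, 1 ≤ i → d.RealizesPiece ν P i

/-- Type 2 (irrational): `g < ∞`, and the last piece has infinitely many segments, `m_g = ∞`. -/
structure IsType2 (ν : AddValuation K (WithTop Γ)) (P : ℕ → K × K) : Prop where
  g_ne_top : d.g ≠ ⊤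
  one_le_g : 1 ≤ d.gNat
  finitePiece : ∀ i, 1 ≤ i → i < d.gNat → d.FinitePiece i
  m_g : d.m d.gNat = ⊤
  one_le : ∀ s, 1 ≤ s → 1 ≤ d.a d.gNat s
  a_ne_top : ∀ s, 1 ≤ s → d.a d.gNat s ≠ ⊤
  realizes : ∀ i, 1 ≤ i → i ≤ d.gNat → d.RealizesPiece ν P i

/-- Type 3 (exceptional curve): `g < ∞`, `m_g < ∞`, and the last segment of the last piece is
infinite, `a_{m_g}^{(g)} = ∞`. -/
structure IsType3 (ν : AddValuation K (WithTop Γ)) (P : ℕ → K × K) : Prop where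
  g_ne_top : d.g ≠ ⊤
  one_le_g : 1 ≤ d.gNat
  finitePiece : ∀ i, 1 ≤ i → i < d.gNat → d.FinitePiece i
  m_g_ne_top : d.m d.gNat ≠ ⊤
  two_le_m_g : 2 ≤ d.numSeg d.gNat
  one_le : ∀ s, 1 ≤ s → s < d.numSeg d.gNat → 1 ≤ d.a d.gNat s
  a_ne_top : ∀ s, 1 ≤ s → s < d.numSeg d.gNat → d.a d.gNat s ≠ ⊤
  a_last : d.a d.gNat (d.numSeg d.gNat) = ⊤
  realizes : ∀ i, 1 ≤ i → i ≤ d.gNat → d.RealizesPiece ν P i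

/-- Type 4.1 (curve valuation of rank 1): `g < ∞` finite pieces followed by an infinite tail
`a_1^{(g+1)} = ∞` consisting of `x`-blowups and infinitely many `z`-blowups, without `y`-blowups (for
`g ≥ 1` the tail starts with a `z`-blowup). -/
structure IsType41 (ν : AddValuation K (WithTop Γ)) (P : ℕ → K × K) : Prop where
  g_ne_top : d.g ≠ ⊤
  finitePiece : ∀ i, 1 ≤ i → i ≤ d.gNat → d.FinitePiece i
  m_tail : d.m (d.gNat + 1) = 1
  a_tail : d.a (d.gNat + 1) 1 = ⊤
  realizes : ∀ i, 1 ≤ i → i ≤ d.gNat → d.RealizesPiece ν P i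
  tail_first : 1 ≤ d.gNat → blowupKind ν (P (d.sigma (d.gNat + 1) 0 0)) = .z
  tail_ne_y : ∀ t, blowupKind ν (P (d.sigma (d.gNat + 1) 0 t)) ≠ .y
  tail_z : ∀ N, ∃ t, N ≤ t ∧ blowupKind ν (P (d.sigma (d.gNat + 1) 0 t)) = .z

/-- Type 4.2 (curve valuation of rank 2): `g < ∞` finite pieces followed by an infinite tail
`a_1^{(g+1)} = ∞` which counts one `z`-blowup (for `g ≥ 1`) followed by infinitely many
`x`-blowups. -/
structure IsType42 (ν : AddValuation K (WithTop Γ)) (P : ℕ → K × K) : Prop where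
  g_ne_top : d.g ≠ ⊤
  finitePiece : ∀ i, 1 ≤ i → i ≤ d.gNat → d.FinitePiece i
  m_tail : d.m (d.gNat + 1) = 1
  a_tail : d.a (d.gNat + 1) 1 = ⊤
  realizes : ∀ i, 1 ≤ i → i ≤ d.gNat + 1 → d.RealizesPiece ν P i

end DualGraphData

/-! ### Generating sequences -/

/-- The value semigroup `{ν(f) | f ∈ 𝔪}`, where `f ≠ 0` so that the values are finite. -/
def valueSemigroup (ν : AddValuation K (WithTop Γ)) : Set (WithTop Γ) :=
  {γ | ∃ f : R, f ∈ maximalIdeal R ∧ f ≠ 0 ∧ ν (algebraMap R K f) = γ}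

variable {R}

/-- `{Q_i}_{i ≤ g'}` (with `g' = ⊤` allowed) is a minimal generating sequence for `ν` of the standard form:
`Q_0 = x`, `Q_1 = y`, each `Q_i` with `i ≥ 2` is `Q_{i-1}^{q_{i-1}}` minus a linear combination with
nonzero coefficients in `k` of finitely many (at least one) monomials in `Q_0, …, Q_{i-2}`, all of
value `q_{i-1} ν(Q_{i-1})`; and the values `ν(Q_i)` generate the value semigroup, while no proper
subfamily obtained by leaving out one `Q_j` does. -/
structure IsMinimalGeneratingSequence (d : DualGraphData) (ν : AddValuation K (WithTop Γ)) (x y : R)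
    (g' : ℕ∞) (Q : ℕ → R) : Prop where
  zero : Q 0 = x
  one : Q 1 = y
  recur : ∀ i : ℕ, 2 ≤ i → (i : ℕ∞) ≤ g' →
    ∃ (δ : ℕ) (u : Fin δ → k) (γ : Fin δ → ℕ → ℕ), 0 < δ ∧ (∀ h, u h ≠ 0) ∧
      (∀ h, ∑ j ∈ Finset.range (i - 1), γ h j • ν (algebraMap R K (Q j))
        = d.q (i - 1) • ν (algebraMap R K (Q (i - 1)))) ∧
      Q i = Q (i - 1) ^ d.q (i - 1)
        - ∑ h, algebraMap k R (u h) * ∏ j ∈ Finset.range (i - 1), Q j ^ γ h j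
  generates : valueSemigroup R ν =
    (AddSubsemigroup.closure {γ | ∃ i : ℕ, (i : ℕ∞) ≤ g' ∧ ν (algebraMap R K (Q i)) = γ} :
      Set (WithTop Γ))
  minimal : ∀ j : ℕ, (j : ℕ∞) ≤ g' → valueSemigroup R ν ≠
    (AddSubsemigroup.closure
      {γ | ∃ i : ℕ, (i : ℕ∞) ≤ g' ∧ i ≠ j ∧ ν (algebraMap R K (Q i)) = γ} : Set (WithTop Γ))

/-- The recursive formula
`ν(Q_i) = q_{i-1} ν(Q_{i-1}) + (1 / (q_1 ⋯ q_{i-1})) (β_i' - 1) β_0`. -/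
def StandardValue [Module ℚ Γ] (d : DualGraphData) (ν : AddValuation K (WithTop Γ)) (Q : ℕ → R)
    (β₀ : Γ) (i : ℕ) : Prop :=
  ν (algebraMap R K (Q i)) = d.q (i - 1) • ν (algebraMap R K (Q (i - 1)))
    + (((1 / (d.qProd (i - 1) : ℚ) * (d.betaPrime i - 1)) • β₀ : Γ) : WithTop Γ)

end Valuation

/-! Let X, Y be the parameters right after the first blowup of the n-th piece. Everything rests on
one identity, ν(Q_n) = q_{n-1} ν(Q_{n-1}) + ν(Y), together with a computation of ν(Y) from the
continued fraction of the piece.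

The identity is proved by induction over the pieces (`IsAdapted`, `IsAdapted.succ`,
`exists_isAdapted`). In the local ring of X, Y every Q_j with j < n is a unit times a power of X,
and Q_n = unit · X^M · (Y + X h). A complete piece with the z-blowup after it is a monomial
substitution X = X'^q U^b, XY = X'^p U^e, where U = Y' + c is a unit, q e - b p = 1 and p/q = β'
(`exists_piece_step`). Hence (XY)^q = X^p U, and Q_n^q is X^D times a unit times U. The monomials of
the recursion have the same value, so each is X^D times a unit as well. Dividing the difference by
X^D and a unit leaves Y' + constant + X' h'.

Minimality removes the two remaining ambiguities (`notMem_partialSemigroup`). A nonzero constant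
would give ν(Q_{n+1}) = q ν(Q_n). If Y' + X' h' had a value other than ν(Y'), that value would be a
multiple of ν(X'), because ν(Y') is not one; then ν(Q_{n+1}) would be a large multiple of ν(X'), and
all these lie in the semigroup of the earlier values.

For ν(Y), the exponents of X and XY in the parameters after some segments are the denominators and
numerators of the convergents (`eq_monomial`). It is XY rather than Y because the first blowup of
the piece is already done; this is the origin of the -1 in β' - 1. For a complete piece ν(X) = q ξ
and ν(XY) = p ξ with ξ = ν(X'). Type 2 passes to the limit of the convergents, Type 3 inserts the
normalization at one level, and in Type 4.2 the first component is found by comparing the value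
group with the semigroup that the ν(Q_i) generate. -/

/-! ### Multiples of a finite positive value -/

section WithTopOrder

variable {Γ : Type*} [AddCommGroup Γ] [LinearOrder Γ] [IsOrderedAddMonoid Γ]

theorem WithTop.nsmul_le_nsmul_iff_of_pos {a : WithTop Γ} (h : 0 < a) (ha : a ≠ ⊤) {m n : ℕ} :
    m • a ≤ n • a ↔ m ≤ n := by
  lift a to Γ using ha
  rw [← WithTop.coe_nsmul, ← WithTop.coe_nsmul, WithTop.coe_le_coe]
  exact nsmul_le_nsmul_iff_left (by exact_mod_cast h)

theorem WithTop.nsmul_lt_nsmul_iff_of_pos {a : WithTop Γ} (h : 0 < a) (ha : a ≠ ⊤) {m n : ℕ} :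
    m • a < n • a ↔ m < n := by
  rw [← not_le, ← not_le, WithTop.nsmul_le_nsmul_iff_of_pos h ha]

theorem WithTop.nsmul_inj_of_pos {a : WithTop Γ} (h : 0 < a) (ha : a ≠ ⊤) {m n : ℕ} :
    m • a = n • a ↔ m = n := by
  simp only [le_antisymm_iff, WithTop.nsmul_le_nsmul_iff_of_pos h ha]

omit [LinearOrder Γ] [IsOrderedAddMonoid Γ] in
theorem WithTop.nsmul_ne_top {a : WithTop Γ} (ha : a ≠ ⊤) (n : ℕ) : n • a ≠ ⊤ := by
  lift a to Γ using ha
  rw [← WithTop.coe_nsmul]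
  exact WithTop.coe_ne_top

theorem WithTop.pos_of_eq_add {a b c : WithTop Γ} (h : b = a + c) (hab : a < b) : 0 < c := by
  rw [h] at hab
  by_contra hc
  have := add_le_add (le_refl a) (not_lt.mp hc)
  rw [add_zero] at this
  exact absurd hab (not_lt.mpr this)

end WithTopOrder

/-! ### The local ring `k[X, Y]_{(X, Y)}` inside a valued field -/

section LocRing

variable (k : Type*) {K Γ : Type*} [Field k] [Field K] [Algebra k K]
  [AddCommGroup Γ] [LinearOrder Γ] [IsOrderedAddMonoid Γ]

/-- The smallest `k`-subalgebra of `K` which contains `X` and `Y` and the inverses of its elements of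
value `0`. If `ν` is positive at `X` and `Y`, it is the localization of `k[X, Y]` at the ideal
`(X, Y)`. -/
inductive LocRing (ν : AddValuation K (WithTop Γ)) (X Y : K) : K → Prop
  | const (c : k) : LocRing ν X Y (algebraMap k K c)
  | fst : LocRing ν X Y X
  | snd : LocRing ν X Y Y
  | add {f g : K} : LocRing ν X Y f → LocRing ν X Y g → LocRing ν X Y (f + g)
  | mul {f g : K} : LocRing ν X Y f → LocRing ν X Y g → LocRing ν X Y (f * g)
  | inv {f : K} : LocRing ν X Y f → ν f = 0 → LocRing ν X Y f⁻¹

/-- `f` is a unit of the local ring `LocRing k ν X Y`. -/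
def IsLocUnit (ν : AddValuation K (WithTop Γ)) (X Y f : K) : Prop := LocRing k ν X Y f ∧ ν f = 0

variable {k} {ν : AddValuation K (WithTop Γ)} {X Y f g : K}

namespace LocRing

theorem zero : LocRing k ν X Y 0 := by simpa using LocRing.const (ν := ν) (X := X) (Y := Y) (0 : k)

theorem one : LocRing k ν X Y 1 := by simpa using LocRing.const (ν := ν) (X := X) (Y := Y) (1 : k)

theorem neg (hf : LocRing k ν X Y f) : LocRing k ν X Y (-f) := by
  simpa using (LocRing.const (-1 : k)).mul hf

theorem sub (hf : LocRing k ν X Y f) (hg : LocRing k ν X Y g) : LocRing k ν X Y (f - g) := by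
  rw [sub_eq_add_neg]; exact hf.add hg.neg

theorem pow (hf : LocRing k ν X Y f) (n : ℕ) : LocRing k ν X Y (f ^ n) := by
  induction n with
  | zero => simpa using one
  | succ n ih => rw [pow_succ]; exact ih.mul hf

theorem sum {ι : Type*} (s : Finset ι) {F : ι → K} (h : ∀ i ∈ s, LocRing k ν X Y (F i)) :
    LocRing k ν X Y (∑ i ∈ s, F i) := by
  classical
  induction s using Finset.induction_on with
  | empty => simpa using zero
  | insert a s ha ih =>
    rw [Finset.sum_insert ha]
    exact (h a (by simp)).add (ih fun i hi => h i (by simp [hi]))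

theorem mono {X' Y' : K} (hf : LocRing k ν X Y f) (hX : LocRing k ν X' Y' X)
    (hY : LocRing k ν X' Y' Y) : LocRing k ν X' Y' f := by
  induction hf with
  | const c => exact .const c
  | fst => exact hX
  | snd => exact hY
  | add _ _ h1 h2 => exact h1.add h2
  | mul _ _ h1 h2 => exact h1.mul h2
  | inv _ h0 h1 => exact h1.inv h0

theorem nonneg (hk : ∀ c : k, c ≠ 0 → ν (algebraMap k K c) = 0) (hX : 0 ≤ ν X) (hY : 0 ≤ ν Y)
    (hf : LocRing k ν X Y f) : 0 ≤ ν f := by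
  induction hf with
  | const c =>
    rcases eq_or_ne c 0 with rfl | hc
    · simp
    · exact (hk c hc).ge
  | fst => exact hX
  | snd => exact hY
  | add _ _ h1 h2 => exact ν.map_le_add h1 h2
  | mul _ _ h1 h2 => rw [ν.map_mul]; exact add_nonneg h1 h2
  | inv _ h0 h1 => rw [ν.map_inv, h0, neg_zero]

end LocRing

namespace IsLocUnit

theorem ne_zero (hf : IsLocUnit k ν X Y f) : f ≠ 0 := by
  rintro rfl
  have := hf.2
  simp at this

theorem one : IsLocUnit k ν X Y 1 := ⟨.one, ν.map_one⟩

theorem mul (hf : IsLocUnit k ν X Y f) (hg : IsLocUnit k ν X Y g) : IsLocUnit k ν X Y (f * g) :=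
  ⟨hf.1.mul hg.1, by rw [ν.map_mul, hf.2, hg.2, add_zero]⟩

theorem inv (hf : IsLocUnit k ν X Y f) : IsLocUnit k ν X Y f⁻¹ :=
  ⟨hf.1.inv hf.2, by rw [ν.map_inv, hf.2, neg_zero]⟩

theorem pow (hf : IsLocUnit k ν X Y f) (n : ℕ) : IsLocUnit k ν X Y (f ^ n) :=
  ⟨hf.1.pow n, by rw [ν.map_pow, hf.2, nsmul_zero]⟩

theorem mono {X' Y' : K} (hf : IsLocUnit k ν X Y f) (hX : LocRing k ν X' Y' X)
    (hY : LocRing k ν X' Y' Y) : IsLocUnit k ν X' Y' f := ⟨hf.1.mono hX hY, hf.2⟩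

/-- A product of monomials in elements of the form `X ^ N * unit` is again of this form. -/
theorem exists_prod_eq {ι : Type*} (s : Finset ι) {F : ι → K} (γ : ι → ℕ)
    (h : ∀ j ∈ s, ∃ N V, IsLocUnit k ν X Y V ∧ F j = X ^ N * V) :
    ∃ N V, IsLocUnit k ν X Y V ∧ ∏ j ∈ s, F j ^ γ j = X ^ N * V := by
  classical
  induction s using Finset.induction_on with
  | empty => exact ⟨0, 1, one, by simp⟩
  | insert a s ha ih =>
    obtain ⟨N, V, hV, e⟩ := ih fun j hj => h j (by simp [hj])
    obtain ⟨N', V', hV', e'⟩ := h a (by simp)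
    refine ⟨N' * γ a + N, V' ^ γ a * V, (hV'.pow _).mul hV, ?_⟩
    rw [Finset.prod_insert ha, e, e', mul_pow, ← pow_mul, pow_add]
    ring

end IsLocUnit

/-- An element of positive value does not change the value of an element of value `0`. -/
theorem AddValuation.map_add_eq_zero_of_pos {f g : K} (hf : ν f = 0) (hg : 0 < ν g) :
    ν (f + g) = 0 := by
  rw [ν.map_add_eq_of_lt_left (by rwa [hf]), hf]

variable (hk : ∀ c : k, c ≠ 0 → ν (algebraMap k K c) = 0)

include hk

namespace LocRing

theorem mul_pos (hX : 0 < ν X) (hY : 0 < ν Y) (hg : 0 < ν g) (hf : LocRing k ν X Y f) :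
    0 < ν (g * f) := by
  rw [ν.map_mul]
  exact add_pos_of_pos_of_nonneg hg (hf.nonneg hk hX.le hY.le)

/-- An element of the local ring is a constant plus an element of the maximal ideal. -/
theorem exists_eq_const_add (hX : 0 < ν X) (hY : 0 < ν Y) (hf : LocRing k ν X Y f) :
    ∃ (c : k) (g h : K), LocRing k ν X Y g ∧ LocRing k ν X Y h ∧
      f = algebraMap k K c + X * g + Y * h := by
  induction hf with
  | const c => exact ⟨c, 0, 0, zero, zero, by simp⟩
  | fst => exact ⟨0, 1, 0, one, zero, by simp⟩
  | snd => exact ⟨0, 0, 1, zero, one, by simp⟩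
  | add _ _ h1 h2 =>
    obtain ⟨c, g, h, hg, hh, rfl⟩ := h1
    obtain ⟨c', g', h', hg', hh', rfl⟩ := h2
    exact ⟨c + c', g + g', h + h', hg.add hg', hh.add hh', by rw [map_add]; ring⟩
  | @mul f₁ f₂ _ hf₂ h1 h2 =>
    obtain ⟨c, g, h, hg, hh, rfl⟩ := h1
    obtain ⟨c', g', h', hg', hh', e⟩ := h2
    refine ⟨c * c', algebraMap k K c * g' + g * f₂, algebraMap k K c * h' + h * f₂,
      ((const c).mul hg').add (hg.mul hf₂), ((const c).mul hh').add (hh.mul hf₂), ?_⟩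
    rw [map_mul]
    linear_combination algebraMap k K c * e
  | @inv f hf h0 h1 =>
    obtain ⟨c, g, h, hg, hh, e⟩ := h1
    have hpos : 0 < ν (X * g + Y * h) :=
      ν.map_lt_add (hg.mul_pos hk hX hY hX) (hh.mul_pos hk hX hY hY)
    have hc : c ≠ 0 := by
      rintro rfl
      rw [map_zero, zero_add] at e
      rw [← e, h0] at hpos
      exact lt_irrefl _ hpos
    have hc' : algebraMap k K c ≠ 0 := by simpa using hc
    have hf0 : f ≠ 0 := by rintro rfl; simp at h0
    have hinv : LocRing k ν X Y (algebraMap k K c)⁻¹ := (const c).inv (hk c hc)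
    -- Since f - c = Xg + Yh, one has f⁻¹ = c⁻¹ - (Xg + Yh) c⁻¹ f⁻¹.
    refine ⟨c⁻¹, -(g * ((algebraMap k K c)⁻¹ * f⁻¹)), -(h * ((algebraMap k K c)⁻¹ * f⁻¹)),
      (hg.mul (hinv.mul (hf.inv h0))).neg, (hh.mul (hinv.mul (hf.inv h0))).neg, ?_⟩
    rw [map_inv₀]
    field_simp
    linear_combination -e

/-- Division by the second variable, with a remainder in the first variable. -/
theorem exists_eq_add_snd_mul (hX : 0 < ν X) (hY : 0 < ν Y) (hf : LocRing k ν X Y f) :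
    ∃ r h : K, LocRing k ν X 0 r ∧ LocRing k ν X Y h ∧ f = r + Y * h := by
  induction hf with
  | const c => exact ⟨_, 0, const c, zero, by simp⟩
  | fst => exact ⟨X, 0, fst, zero, by simp⟩
  | snd => exact ⟨0, 1, zero, one, by simp⟩
  | add _ _ h1 h2 =>
    obtain ⟨r, h, hr, hh, rfl⟩ := h1
    obtain ⟨r', h', hr', hh', rfl⟩ := h2
    exact ⟨r + r', h + h', hr.add hr', hh.add hh', by ring⟩
  | @mul f₁ f₂ _ hf₂ h1 h2 =>
    obtain ⟨r, h, hr, hh, rfl⟩ := h1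
    obtain ⟨r', h', hr', hh', e⟩ := h2
    refine ⟨r * r', r * h' + h * f₂, hr.mul hr', ((hr.mono fst zero).mul hh').add (hh.mul hf₂), ?_⟩
    linear_combination r * e
  | @inv f hf h0 h1 =>
    obtain ⟨r, h, hr, hh, e⟩ := h1
    have hr0 : ν r = 0 := by
      rw [show r = f + -(Y * h) by rw [e]; ring]
      exact AddValuation.map_add_eq_zero_of_pos h0
        (by rw [ν.map_neg]; exact hh.mul_pos hk hX hY hY)
    have hf0 : f ≠ 0 := by rintro rfl; simp at h0
    have hr' : r ≠ 0 := by rintro rfl; simp at hr0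
    refine ⟨r⁻¹, -(h * (r⁻¹ * f⁻¹)), hr.inv hr0,
      (hh.mul (((hr.inv hr0).mono fst zero).mul (hf.inv h0))).neg, ?_⟩
    field_simp
    linear_combination -e

omit hk in
theorem aeval (p : Polynomial k) : LocRing k ν X 0 (Polynomial.aeval X p) := by
  induction p using Polynomial.induction_on' with
  | add p q hp hq => rw [map_add]; exact hp.add hq
  | monomial n a => rw [Polynomial.aeval_monomial]; exact (const a).mul (fst.pow n)

-- Fractions of polynomials in X whose denominators have value 0 are closed under all the operations
-- of `LocRing k ν X 0`. Inversion swaps numerator and denominator, and the numerator has value 0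
-- because the fraction does. Thus `LocRing k ν X 0` serves as k[X] localized at (X).
omit hk in
theorem exists_mul_aeval_eq (hf : LocRing k ν X 0 f) :
    ∃ p s : Polynomial k, ν (Polynomial.aeval X s) = 0 ∧
      f * Polynomial.aeval X s = Polynomial.aeval X p := by
  induction hf with
  | const c => exact ⟨.C c, 1, by simp, by simp⟩
  | fst => exact ⟨.X, 1, by simp, by simp⟩
  | snd => exact ⟨0, 1, by simp, by simp⟩
  | add _ _ h1 h2 =>
    obtain ⟨p, s, hs, e⟩ := h1
    obtain ⟨p', s', hs', e'⟩ := h2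
    refine ⟨p * s' + p' * s, s * s', by rw [map_mul, ν.map_mul, hs, hs', add_zero], ?_⟩
    simp only [map_mul, map_add, ← e, ← e']
    ring
  | mul _ _ h1 h2 =>
    obtain ⟨p, s, hs, e⟩ := h1
    obtain ⟨p', s', hs', e'⟩ := h2
    refine ⟨p * p', s * s', by rw [map_mul, ν.map_mul, hs, hs', add_zero], ?_⟩
    simp only [map_mul, ← e, ← e']
    ring
  | @inv f _ h0 h1 =>
    obtain ⟨p, s, hs, e⟩ := h1
    refine ⟨s, p, by rw [← e, ν.map_mul, h0, hs, add_zero], ?_⟩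
    have hf0 : f ≠ 0 := by rintro rfl; simp at h0
    rw [← e]
    field_simp

/-- A nonzero element of `k[X]_{(X)}` is a power of `X` times a unit. -/
theorem exists_eq_pow_mul (hX : 0 < ν X) (hf : LocRing k ν X 0 f) (hf0 : f ≠ 0) :
    ∃ N u, IsLocUnit k ν X 0 u ∧ f = X ^ N * u := by
  obtain ⟨p, s, hs, e⟩ := hf.exists_mul_aeval_eq
  have hsu : IsLocUnit k ν X 0 (Polynomial.aeval X s) := ⟨aeval s, hs⟩
  have hp : p ≠ 0 := by
    rintro rfl
    rw [map_zero, mul_eq_zero] at e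
    exact e.elim hf0 hsu.ne_zero
  obtain ⟨p', hp', hdvd⟩ := Polynomial.exists_eq_pow_rootMultiplicity_mul_and_not_dvd p hp 0
  set N := p.rootMultiplicity 0
  rw [map_zero, sub_zero] at hp' hdvd
  have hu : IsLocUnit k ν X 0 (Polynomial.aeval X p') := by
    refine ⟨aeval p', ?_⟩
    rw [Polynomial.X_dvd_iff] at hdvd
    rw [← Polynomial.divX_mul_X_add p', map_add, map_mul, Polynomial.aeval_C, Polynomial.aeval_X,
      add_comm, mul_comm]
    -- The constant term is nonzero because X does not divide p', and the remaining terms have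
    -- positive value. The second variable `0` has value `⊤`, which counts as positive.
    exact AddValuation.map_add_eq_zero_of_pos (hk _ hdvd)
      ((aeval _).mul_pos hk hX (by simp) hX)
  refine ⟨N, _, hu.mul hsu.inv, ?_⟩
  rw [← mul_assoc, eq_mul_inv_iff_mul_eq₀ hsu.ne_zero, e]
  conv_lhs => rw [hp']
  simp

end LocRing

end LocRing

/-! ### Parameters adapted to a generating sequence -/

theorem AddSubsemigroup.succ_nsmul_mem {M : Type*} [AddMonoid M] (S : AddSubsemigroup M) {a : M}
    (ha : a ∈ S) (n : ℕ) : (n + 1) • a ∈ S := by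
  induction n with
  | zero => simpa using ha
  | succ n ih => rw [succ_nsmul]; exact S.add_mem ih ha

theorem AddSubsemigroup.nsmul_add_mem {M : Type*} [AddMonoid M] (S : AddSubsemigroup M) {a b : M}
    (ha : a ∈ S) (hb : b ∈ S) (n : ℕ) : n • a + b ∈ S := by
  cases n with
  | zero => simpa using hb
  | succ n => exact S.add_mem (S.succ_nsmul_mem ha n) hb

/-- If `q` and `a` are coprime, every integer is congruent modulo `q` to a multiple `s * a` with
`s < q`; for `n ≥ q * a` the quotient is large. -/
theorem Nat.exists_eq_mul_add_mul_of_coprime {q a n : ℕ} (hq : 1 < q) (h : Nat.Coprime a q)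
    (hn : q * a ≤ n) : ∃ s n', n = s * a + q * n' ∧ a ≤ q * n' := by
  obtain ⟨s, hs, hmod⟩ : ∃ s < q, s * a ≡ n [MOD q] := by
    obtain ⟨b, -, hb⟩ := Nat.exists_mul_mod_eq_one_of_coprime h hq
    refine ⟨n * b % q, Nat.mod_lt _ (by omega), ?_⟩
    calc n * b % q * a ≡ n * b * a [MOD q] := (Nat.mod_modEq _ _).mul_right a
      _ = n * (a * b) := by ring
      _ ≡ n * 1 [MOD q] := Nat.ModEq.mul_left n (hb.trans (Nat.mod_eq_of_lt hq).symm)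
      _ = n := mul_one n
  -- From s + 1 ≤ q follows (s + 1) a ≤ q a ≤ n; this bounds the quotient from below.
  have hle : s * a + a ≤ n := by nlinarith
  obtain ⟨n', hn'⟩ := (Nat.modEq_iff_dvd' (by omega)).mp hmod
  exact ⟨s, n', by omega, by omega⟩

section Adapted

variable (k : Type*) {K Γ : Type*} [Field k] [Field K] [Algebra k K]
  [AddCommGroup Γ] [LinearOrder Γ] [IsOrderedAddMonoid Γ]

/-- The semigroup generated by the values of `Q 0, …, Q (i - 1)`. -/
def partialSemigroup (ν : AddValuation K (WithTop Γ)) (Q : ℕ → K) (i : ℕ) :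
    AddSubsemigroup (WithTop Γ) := AddSubsemigroup.closure {γ | ∃ j < i, ν (Q j) = γ}

/-- In the parameters `X, Y` the elements `Q 0, …, Q (i - 1)` are monomials in `X` up to units, and
`Q i` is a unit times `X ^ M` times a parameter `Y + X * h` which has the same value as `Y`. -/
structure IsAdapted (ν : AddValuation K (WithTop Γ)) (Q : ℕ → K) (i q₀ : ℕ) (X Y : K) (M : ℕ) :
    Prop where
  fst_ne_zero : X ≠ 0
  fst_pos : 0 < ν X
  snd_pos : 0 < ν Y
  one_le : 1 ≤ M
  lower : ∀ j < i, ∃ N V, IsLocUnit k ν X Y V ∧ Q j = X ^ N * V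
  top : ∃ V h, IsLocUnit k ν X Y V ∧ LocRing k ν X Y h ∧ Q i = X ^ M * V * (Y + X * h) ∧
    ν (Y + X * h) = ν Y
  nsmul_eq : M • ν X = q₀ • ν (Q (i - 1))
  conductor : ∀ n, M ≤ n → n • ν X ∈ partialSemigroup ν Q i

variable {k} {ν : AddValuation K (WithTop Γ)} {X Y X' Y' : K} {Q : ℕ → K} {i q₀ M : ℕ}

theorem partialSemigroup_mono {i j : ℕ} (h : i ≤ j) :
    partialSemigroup ν Q i ≤ partialSemigroup ν Q j :=
  AddSubsemigroup.closure_mono fun _ ⟨l, hl, e⟩ => ⟨l, hl.trans_le h, e⟩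

theorem mem_partialSemigroup {i j : ℕ} (h : j < i) : ν (Q j) ∈ partialSemigroup ν Q i :=
  AddSubsemigroup.subset_closure ⟨j, h, rfl⟩

/-- The payoff of adaptedness: units contribute nothing, X ^ M contributes the multiple of the
preceding value, and the last factor has the value of Y. -/
theorem IsAdapted.value_eq (h : IsAdapted k ν Q i q₀ X Y M) :
    ν (Q i) = q₀ • ν (Q (i - 1)) + ν Y := by
  obtain ⟨V, g, hV, _, e, hv⟩ := h.top
  rw [e, ν.map_mul, ν.map_mul, ν.map_pow, hV.2, add_zero, hv, h.nsmul_eq]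

theorem LocRing.exists_one_add_pow {w : K} (hw : LocRing k ν X Y w) (n : ℕ) :
    ∃ w', LocRing k ν X Y w' ∧ (1 + X * w) ^ n = 1 + X * w' := by
  induction n with
  | zero => exact ⟨0, .zero, by simp⟩
  | succ n ih =>
    obtain ⟨w', hw', e⟩ := ih
    exact ⟨w' * (1 + X * w) + w, (hw'.mul (.add .one (.mul .fst hw))).add hw, by
      rw [pow_succ, e]; ring⟩

variable (hk : ∀ c : k, c ≠ 0 → ν (algebraMap k K c) = 0)

include hk

/-- If `Y` has positive value, `X * h` is a power of `X` times a unit or `0`, up to an element of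
`X * Y * LocRing`. -/
theorem LocRing.exists_add_fst_mul_eq (hX : 0 < ν X) (hY : 0 < ν Y) {h : K}
    (hh : LocRing k ν X Y h) :
    ∃ h₂, LocRing k ν X Y h₂ ∧ (Y + X * h = Y * (1 + X * h₂) ∨
      ∃ N u, IsLocUnit k ν X Y u ∧ Y + X * h = X ^ (N + 1) * u + Y * (1 + X * h₂)) := by
  obtain ⟨r, h₂, hr, hh₂, rfl⟩ := hh.exists_eq_add_snd_mul hk hX hY
  refine ⟨h₂, hh₂, ?_⟩
  rcases eq_or_ne r 0 with rfl | hr0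
  · left; ring
  · obtain ⟨N, u, hu, rfl⟩ := hr.exists_eq_pow_mul hk hX hr0
    exact Or.inr ⟨N, u, hu.mono .fst .zero, by ring⟩

theorem LocRing.one_add_fst_mul (hX : 0 < ν X) (hY : 0 < ν Y) {h : K} (hh : LocRing k ν X Y h) :
    IsLocUnit k ν X Y (1 + X * h) :=
  ⟨.add .one (.mul .fst hh), AddValuation.map_add_eq_zero_of_pos ν.map_one (hh.mul_pos hk hX hY hX)⟩

/-- If the value of `Y` is not a multiple of that of `X`, then either `Y + X * h` has the same value as
`Y`, or its value is a multiple of that of `X`. -/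
theorem LocRing.map_add_fst_mul (hX : 0 < ν X) (hY : 0 < ν Y) (hnon : ∀ n : ℕ, ν Y ≠ n • ν X)
    {h : K} (hh : LocRing k ν X Y h) :
    ν (Y + X * h) = ν Y ∨ ∃ n : ℕ, ν (Y + X * h) = n • ν X := by
  obtain ⟨h₂, hh₂, e | ⟨N, u, hu, e⟩⟩ := hh.exists_add_fst_mul_eq hk hX hY
  · left
    rw [e, ν.map_mul, (hh₂.one_add_fst_mul hk hX hY).2, add_zero]
  · have h1 : ν (Y * (1 + X * h₂)) = ν Y := by
      rw [ν.map_mul, (hh₂.one_add_fst_mul hk hX hY).2, add_zero]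
    have h2 : ν (X ^ (N + 1) * u) = (N + 1) • ν X := by rw [ν.map_mul, ν.map_pow, hu.2, add_zero]
    rcases lt_trichotomy (ν Y) ((N + 1) • ν X) with hlt | heq | hgt
    · left
      rw [e, ν.map_add_eq_of_lt_right (by rwa [h1, h2]), h1]
    · exact absurd heq (hnon _)
    · right
      exact ⟨N + 1, by rw [e, ν.map_add_eq_of_lt_left (by rwa [h1, h2]), h2]⟩

/-- Passing from the parameters at the beginning of a piece to those at the beginning of the next
one, `Y + X * h` becomes `Y * (1 + X' * w)`. -/
theorem LocRing.exists_add_fst_mul_eq_mul_one_add {U : K} {q p p₁ b : ℕ} (hX' : 0 < ν X')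
    (hX'0 : X' ≠ 0) (hX : 0 < ν X) (hY : 0 < ν Y) (hU : IsLocUnit k ν X' Y' U) (hq : 2 ≤ q)
    (hp : p = q + p₁) (hcop : Nat.Coprime p q) (heX : X = X' ^ q * U ^ b) {V₀ : K}
    (hV₀ : IsLocUnit k ν X' Y' V₀) (heY : Y = X' ^ p₁ * V₀) (hp₁ : 1 ≤ p₁) {h : K}
    (hh : LocRing k ν X Y h) (hv : ν (Y + X * h) = ν Y) :
    ∃ w, LocRing k ν X' Y' w ∧ Y + X * h = Y * (1 + X' * w) := by
  have hXL : LocRing k ν X' Y' X := by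
    rw [heX]; exact (LocRing.fst.pow q).mul (hU.1.pow b)
  have hYL : LocRing k ν X' Y' Y := by
    rw [heY]; exact (LocRing.fst.pow _).mul hV₀.1
  have hXX' : X = X' * (X' ^ (q - 1) * U ^ b) := by
    rw [heX, ← mul_assoc, ← pow_succ', Nat.sub_add_cancel (by omega)]
  have hx1 : LocRing k ν X' Y' (X' ^ (q - 1) * U ^ b) := (LocRing.fst.pow _).mul (hU.1.pow b)
  have hfin : ν X' ≠ ⊤ := by rwa [Ne, ν.top_iff]
  have hνX : ν X = q • ν X' := by
    rw [heX, ν.map_mul, ν.map_pow, (hU.pow b).2, add_zero]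
  have hνY : ν Y = p₁ • ν X' := by
    rw [heY, ν.map_mul, ν.map_pow, hV₀.2, add_zero]
  obtain ⟨h₂, hh₂, e | ⟨N, u, hu, e⟩⟩ := hh.exists_add_fst_mul_eq hk hX hY
  · exact ⟨X' ^ (q - 1) * U ^ b * h₂, hx1.mul (hh₂.mono hXL hYL), by
      rw [e]; linear_combination Y * h₂ * hXX'⟩
  · have h1 : ν Y ≤ ν (X ^ (N + 1) * u) := by
      rw [show X ^ (N + 1) * u = (Y + X * h) - Y * (1 + X * h₂) by rw [e]; ring]
      refine ν.map_le_sub hv.ge ?_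
      rw [ν.map_mul, (hh₂.one_add_fst_mul hk hX hY).2, add_zero]
    rw [ν.map_mul, ν.map_pow, hu.2, add_zero, hνX, hνY, smul_smul,
      WithTop.nsmul_le_nsmul_iff_of_pos hX' hfin] at h1
    -- Equality would make q divide p. So the inequality of exponents is strict, which leaves a
    -- spare factor X' in X^(N+1) / Y.
    have hne : p₁ ≠ (N + 1) * q := by
      rintro rfl
      have : q ∣ p := by rw [hp]; exact dvd_add dvd_rfl (dvd_mul_left _ _)
      have := Nat.Coprime.eq_one_of_dvd hcop.symm this
      omega
    obtain ⟨D, hD⟩ : ∃ D, (N + 1) * q = p₁ + 1 + D := Nat.exists_eq_add_of_le (by omega)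
    refine ⟨X' ^ D * U ^ (b * (N + 1)) * V₀⁻¹ * u + X' ^ (q - 1) * U ^ b * h₂,
      (((((LocRing.fst.pow _).mul (hU.1.pow _)).mul hV₀.inv.1).mul (hu.1.mono hXL hYL)).add
        (hx1.mul (hh₂.mono hXL hYL))), ?_⟩
    have h3 : X ^ (N + 1) = Y * (X' * (X' ^ D * U ^ (b * (N + 1)) * V₀⁻¹)) := by
      have := hV₀.ne_zero
      rw [heX, heY, mul_pow, ← pow_mul, ← pow_mul, mul_comm q, hD, pow_add, pow_add]
      field_simp
    rw [e, h3]
    linear_combination Y * h₂ * hXX'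

/-- The step from one piece to the next one. -/
theorem IsAdapted.succ {q p b e : ℕ} {c : k} (hA : IsAdapted k ν Q i q₀ X Y M)
    (hc : c ≠ 0) (hX' : 0 < ν X') (hY' : 0 < ν Y')
    (heX : X = X' ^ q * (Y' + algebraMap k K c) ^ b)
    (heXY : X * Y = X' ^ p * (Y' + algebraMap k K c) ^ e)
    (hdet : q * e = b * p + 1) (hq : 2 ≤ q)
    (hnon : ∀ n : ℕ, ν Y' ≠ n • ν X')
    {δ : ℕ} {u : Fin δ → k} {γ : Fin δ → ℕ → ℕ}
    (hval : ∀ h, ∑ j ∈ Finset.range i, γ h j • ν (Q j) = q • ν (Q i))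
    (hQ : Q (i + 1) = Q i ^ q
      - ∑ h, algebraMap k K (u h) * ∏ j ∈ Finset.range i, Q j ^ γ h j)
    (hmin : ν (Q (i + 1)) ∉ partialSemigroup ν Q (i + 1)) :
    ∃ M', IsAdapted k ν Q (i + 1) q X' Y' M' := by
  set U := Y' + algebraMap k K c with hUdef
  have hX'0 : X' ≠ 0 := by
    rintro rfl
    exact hA.fst_ne_zero (by rw [heX, zero_pow (by omega), zero_mul])
  have hU : IsLocUnit k ν X' Y' U := ⟨.add .snd (.const c), by
    rw [hUdef, add_comm]; exact AddValuation.map_add_eq_zero_of_pos (hk c hc) hY'⟩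
  have hU0 := hU.ne_zero
  have hfin : ν X' ≠ ⊤ := by rwa [Ne, ν.top_iff]
  have hνX : ν X = q • ν X' := by
    rw [heX, ν.map_mul, ν.map_pow, (hU.pow b).2, add_zero]
  -- This reflects ν(XY) > ν(X).
  have hpq : q < p := by
    rw [← WithTop.nsmul_lt_nsmul_iff_of_pos hX' hfin]
    have h1 : ν (X * Y) = p • ν X' := by
      rw [heXY, ν.map_mul, ν.map_pow, (hU.pow e).2, add_zero]
    rw [← h1, ν.map_mul, ← hνX]
    have hXfin : ν X ≠ ⊤ := by rw [Ne, ν.top_iff]; exact hA.fst_ne_zero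
    have := WithTop.add_lt_add_left hXfin hA.snd_pos
    rwa [add_zero] at this
  obtain ⟨p₁, hp⟩ := Nat.exists_eq_add_of_le hpq.le
  have hp₁ : 1 ≤ p₁ := by omega
  have hcop : Nat.Coprime p q := by
    rw [Nat.coprime_comm]
    refine Nat.Coprime.of_dvd_right (Dvd.intro_left b rfl) ?_
    have : Nat.Coprime (q * e) (b * p) := by rw [hdet]; simp
    exact this.coprime_mul_right
  obtain ⟨V₀, hV₀def⟩ : ∃ V₀, V₀ = U ^ e * (U ^ b)⁻¹ := ⟨_, rfl⟩
  have hV₀ : IsLocUnit k ν X' Y' V₀ := by rw [hV₀def]; exact (hU.pow e).mul (hU.pow b).inv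
  have heY : Y = X' ^ p₁ * V₀ := by
    have h1 : X * Y = X * (X' ^ p₁ * V₀) := by
      rw [heXY, heX, hV₀def, hp, pow_add]
      field_simp
    exact mul_left_cancel₀ hA.fst_ne_zero h1
  have hXL : LocRing k ν X' Y' X := by rw [heX]; exact (LocRing.fst.pow q).mul (hU.1.pow b)
  have hYL : LocRing k ν X' Y' Y := by rw [heY]; exact (LocRing.fst.pow _).mul hV₀.1
  have hνY : ν Y = p₁ • ν X' := by rw [heY, ν.map_mul, ν.map_pow, hV₀.2, add_zero]
  obtain ⟨V, h, hV, hh, hQi, hv⟩ := hA.top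
  obtain ⟨w, hw, hTw⟩ := hh.exists_add_fst_mul_eq_mul_one_add hk hX' hX'0 hA.fst_pos hA.snd_pos hU hq
    hp hcop heX hV₀ heY hp₁ hv
  rw [hTw] at hQi
  have hWu : IsLocUnit k ν X' Y' (1 + X' * w) := hw.one_add_fst_mul hk hX' hY'
  have hV' : IsLocUnit k ν X' Y' V := hV.mono hXL hYL
  -- the elements `Q j`, `j ≤ i`, in the new parameters
  have hlow : ∀ j < i + 1, ∃ N V, IsLocUnit k ν X' Y' V ∧ Q j = X' ^ N * V := by
    intro j hj
    rcases Nat.lt_succ_iff_lt_or_eq.mp hj with hj | rfl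
    · obtain ⟨N, V, hV, e⟩ := hA.lower j hj
      refine ⟨q * N, U ^ (b * N) * V, (hU.pow _).mul (hV.mono hXL hYL), ?_⟩
      rw [e, heX, mul_pow, ← pow_mul, ← pow_mul, mul_assoc]
    · refine ⟨q * M + p₁, U ^ (b * M) * V * V₀ * (1 + X' * w),
        (((hU.pow _).mul hV').mul hV₀).mul hWu, ?_⟩
      rw [hQi, heX, heY, mul_pow, ← pow_mul, ← pow_mul, pow_add]
      ring
  obtain ⟨D, hD⟩ : ∃ D, D = q * M + p₁ := ⟨_, rfl⟩
  have hνQi : ν (Q i) = D • ν X' := by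
    rw [hQi, ν.map_mul, ν.map_mul, ν.map_mul, ν.map_pow, hV.2, hWu.2, hνX, hνY, hD, add_smul,
      smul_smul, mul_comm M, add_zero, add_zero]
  -- the monomials in the recursion
  have hmon : ∀ a, ∃ V, IsLocUnit k ν X Y V ∧ ∏ j ∈ Finset.range i, Q j ^ γ a j = X ^ D * V := by
    intro a
    obtain ⟨N, V, hV, e⟩ := IsLocUnit.exists_prod_eq (Finset.range i) (γ a)
      fun j hj => hA.lower j (Finset.mem_range.mp hj)
    refine ⟨V, hV, ?_⟩
    -- The prescribed value q ν(Q_i) = D ν(X) fixes the exponent of X, so all monomials share the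
    -- same power X^D.
    have h1 : ν (∏ j ∈ Finset.range i, Q j ^ γ a j) = q • ν (Q i) := by
      rw [← hval a]
      clear e
      induction Finset.range i using Finset.cons_induction with
      | empty => simp
      | cons a s ha ih => rw [Finset.prod_cons, Finset.sum_cons, ν.map_mul, ν.map_pow, ih]
    rw [e, ν.map_mul, ν.map_pow, hV.2, add_zero, hνQi, hνX, smul_smul, smul_smul,
      WithTop.nsmul_inj_of_pos hX' hfin, mul_comm] at h1
    rw [e, Nat.eq_of_mul_eq_mul_left (by omega) h1]
  choose G hG hGe using hmon
  -- The expansion is made in the old parameters: the part in (X, Y) becomes divisible by X', while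
  -- the constant g₀ survives to be compared with c.
  have hG₀ : LocRing k ν X Y ((V ^ q)⁻¹ * ∑ a, algebraMap k K (u a) * G a) :=
    (hV.pow q).inv.1.mul (LocRing.sum _ fun a _ => (LocRing.const _).mul (hG a).1)
  obtain ⟨g₀, g₁, g₂, hg₁, hg₂, hge⟩ := hG₀.exists_eq_const_add hk hA.fst_pos hA.snd_pos
  -- The determinant relation q e = b p + 1 gives (XY)^q = X^p U, with exactly one factor U.
  -- Multiplying by X^q makes this relation applicable.
  have hpowQ : Q i ^ q = X ^ D * V ^ q * ((1 + X' * w) ^ q * U) := by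
    have h1 : Q i ^ q * X ^ q = X ^ D * V ^ q * ((1 + X' * w) ^ q * U) * X ^ q := by
      have h2 : X ^ q * Y ^ q = X ^ p * U := by
        rw [← mul_pow, heXY, heX, mul_pow, mul_pow, ← pow_mul, ← pow_mul, ← pow_mul, ← pow_mul,
          mul_comm e, hdet, pow_succ, mul_comm p]
        ring
      calc Q i ^ q * X ^ q = (X ^ M) ^ q * V ^ q * (1 + X' * w) ^ q * (X ^ q * Y ^ q) := by
            rw [hQi, mul_pow, mul_pow, mul_pow]; ring
        _ = _ := by rw [h2, hD, hp, ← pow_mul]; ring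
    exact mul_right_cancel₀ (pow_ne_zero _ hA.fst_ne_zero) h1
  obtain ⟨w', hw', hwe⟩ := hw.exists_one_add_pow q
  have hXX' : X = X' * (X' ^ (q - 1) * U ^ b) := by
    rw [heX, ← mul_assoc, ← pow_succ', Nat.sub_add_cancel (by omega)]
  have hYX' : Y = X' * (X' ^ (p₁ - 1) * V₀) := by
    rw [heY, ← mul_assoc, ← pow_succ', Nat.sub_add_cancel (by omega)]
  set h' := w' * U - (X' ^ (q - 1) * U ^ b * g₁ + X' ^ (p₁ - 1) * V₀ * g₂) with hh'def
  have hh' : LocRing k ν X' Y' h' := (hw'.mul hU.1).sub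
    ((((LocRing.fst.pow _).mul (hU.1.pow _)).mul (hg₁.mono hXL hYL)).add
      (((LocRing.fst.pow _).mul hV₀.1).mul (hg₂.mono hXL hYL)))
  have hQsucc : Q (i + 1) = X ^ D * V ^ q * (Y' + algebraMap k K (c - g₀) + X' * h') := by
    have hVq := (hV.pow q).ne_zero
    have h1 : ∑ a, algebraMap k K (u a) * ∏ j ∈ Finset.range i, Q j ^ γ a j
        = X ^ D * V ^ q * ((V ^ q)⁻¹ * ∑ a, algebraMap k K (u a) * G a) := by
      rw [← mul_assoc, mul_assoc _ (V ^ q), mul_inv_cancel₀ hVq, mul_one, Finset.mul_sum]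
      exact Finset.sum_congr rfl fun a _ => by rw [hGe]; ring
    rw [hQ, h1, hge, hpowQ, hwe, ← mul_sub]
    congr 1
    rw [hh'def, map_sub]
    linear_combination (-g₁) * hXX' - g₂ * hYX'
  -- Otherwise the last factor is a unit and ν(Q_{i+1}) = q ν(Q_i), which minimality forbids.
  have hcg : c - g₀ = 0 := by
    by_contra hne
    refine hmin ?_
    have h1 : ν (Y' + algebraMap k K (c - g₀) + X' * h') = 0 := by
      rw [show Y' + algebraMap k K (c - g₀) + X' * h'
        = algebraMap k K (c - g₀) + (Y' + X' * h') by ring]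
      exact AddValuation.map_add_eq_zero_of_pos (hk _ hne)
        (ν.map_lt_add hY' (hh'.mul_pos hk hX' hY' hX'))
    rw [hQsucc, ν.map_mul, ν.map_mul, h1, add_zero, (hV.pow q).2, add_zero, ν.map_pow, hνX,
      smul_smul, mul_comm, ← smul_smul, ← hνQi]
    obtain ⟨q', rfl⟩ : ∃ q', q = q' + 1 := ⟨q - 1, by omega⟩
    exact AddSubsemigroup.succ_nsmul_mem _ (mem_partialSemigroup (Nat.lt_succ_self i)) _
  rw [hcg, map_zero, add_zero] at hQsucc
  -- every large multiple of the value of `X'` lies in the semigroup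
  have hcond : ∀ n, q * D ≤ n → n • ν X' ∈ partialSemigroup ν Q (i + 1) := by
    intro n hn
    have hcop' : Nat.Coprime D q := by
      rw [hp, Nat.coprime_self_add_left] at hcop
      rw [hD, Nat.coprime_mul_left_add_left]
      exact hcop
    -- The summand s D ν(X') is s ν(Q_i), and q n' ν(X') = n' ν(X) is covered by the old conductor,
    -- since q n' ≥ D ≥ q M.
    obtain ⟨s, n', rfl, hn'⟩ := Nat.exists_eq_mul_add_mul_of_coprime (by omega) hcop' hn
    have hM : M ≤ n' := by
      refine Nat.le_of_mul_le_mul_left (c := q) ?_ (by omega)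
      omega
    rw [add_smul, ← smul_smul, ← hνQi, mul_comm q, ← smul_smul, ← hνX]
    exact AddSubsemigroup.nsmul_add_mem _ (mem_partialSemigroup (Nat.lt_succ_self i))
      (partialSemigroup_mono (Nat.le_succ i) (hA.conductor n' hM)) s
  have hXD : X ^ D * V ^ q = X' ^ (q * D) * (U ^ (b * D) * V ^ q) := by
    rw [heX, mul_pow, ← pow_mul, ← pow_mul, mul_assoc]
  have hVnew : IsLocUnit k ν X' Y' (U ^ (b * D) * V ^ q) := (hU.pow _).mul (hV'.pow q)
  -- In the other case ν(Q_{i+1}) is a multiple of ν(X') beyond the conductor q D, contrary to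
  -- minimality.
  have hvnew : ν (Y' + X' * h') = ν Y' := by
    rcases hh'.map_add_fst_mul hk hX' hY' hnon with h1 | ⟨n, h1⟩
    · exact h1
    · refine absurd ?_ hmin
      rw [hQsucc, hXD, ν.map_mul, ν.map_mul, hVnew.2, add_zero, ν.map_pow, h1, ← add_smul]
      exact hcond _ (by omega)
  refine ⟨q * D, hX'0, hX', hY', ?_, hlow,
    ⟨U ^ (b * D) * V ^ q, h', hVnew, hh', by rw [hQsucc, hXD], hvnew⟩, ?_, hcond⟩
  · have : 1 ≤ D := by omega
    nlinarith
  · rw [Nat.add_sub_cancel, hνQi, smul_smul]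

end Adapted

/-! ### Continuants -/

section Continuants

/-- Numerators of the convergents of `[a 0, a 1, …]`. -/
def contNum (a : ℕ → ℕ) : ℕ → ℕ
  | 0 => 1
  | 1 => a 0
  | n + 2 => a (n + 1) * contNum a (n + 1) + contNum a n

/-- Denominators of the convergents of `[a 0, a 1, …]`. -/
def contDen (a : ℕ → ℕ) : ℕ → ℕ
  | 0 => 0
  | 1 => 1
  | n + 2 => a (n + 1) * contDen a (n + 1) + contDen a n

variable (a : ℕ → ℕ)

/-- Each step of the recursion changes the sign of the determinant of consecutive continuants. Both
signs are recorded separately so that the identities hold without subtraction in ℕ. -/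
theorem cont_det_of_even {n : ℕ} (hn : Even n) :
    contNum a n * contDen a (n + 1) = contDen a n * contNum a (n + 1) + 1 ∧
      contDen a (n + 1) * contNum a (n + 2) = contNum a (n + 1) * contDen a (n + 2) + 1 := by
  have step1 : ∀ n, contNum a n * contDen a (n + 1) = contDen a n * contNum a (n + 1) + 1 →
      contDen a (n + 1) * contNum a (n + 2) = contNum a (n + 1) * contDen a (n + 2) + 1 := by
    intro n h
    simp only [contNum, contDen]
    linarith
  have step2 : ∀ n, contDen a (n + 1) * contNum a (n + 2) = contNum a (n + 1) * contDen a (n + 2) + 1 →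
      contNum a (n + 2) * contDen a (n + 3) = contDen a (n + 2) * contNum a (n + 3) + 1 := by
    intro n h
    simp only [contNum, contDen] at h ⊢
    linarith
  obtain ⟨m, rfl⟩ := hn
  have key : contNum a (m + m) * contDen a (m + m + 1)
      = contDen a (m + m) * contNum a (m + m + 1) + 1 := by
    induction m with
    | zero => simp [contNum, contDen]
    | succ m ih =>
      have := step2 _ (step1 _ ih)
      rwa [show m + 1 + (m + 1) = m + m + 2 by ring]
  exact ⟨key, step1 _ key⟩

theorem cont_coprime (n : ℕ) : Nat.Coprime (contNum a (n + 1)) (contDen a (n + 1)) := by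
  rcases Nat.even_or_odd n with h | h
  · have := (cont_det_of_even a h).1
    refine Nat.Coprime.symm (Nat.Coprime.of_dvd (Dvd.intro_left (contNum a n) rfl)
      (Dvd.intro_left (contDen a n) rfl) ?_)
    rw [this]; simp
  · obtain ⟨m, rfl⟩ := h
    have := (cont_det_of_even a (even_two_mul m)).2
    refine Nat.Coprime.of_dvd (Dvd.intro_left (contDen a (2 * m + 1)) rfl)
      (Dvd.intro_left (contNum a (2 * m + 1)) rfl) ?_
    rw [this]; simp

theorem contDen_pos {n : ℕ} (ha : ∀ j, j ≠ 0 → j ≤ n → 1 ≤ a j) : 1 ≤ contDen a (n + 1) := by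
  induction n with
  | zero => simp [contDen]
  | succ n ih =>
    have := Nat.mul_le_mul (ha (n + 1) (by omega) le_rfl) (ih fun j h0 hj => ha j h0 (by omega))
    simp only [contDen]
    omega

theorem le_contDen (ha : ∀ j, j ≠ 0 → 1 ≤ a j) (n : ℕ) : n ≤ contDen a (n + 1) := by
  induction n with
  | zero => simp
  | succ n ih =>
    have h1 := Nat.mul_le_mul (ha (n + 1) (by omega)) (le_refl (contDen a (n + 1)))
    rw [one_mul] at h1
    -- `contDen a 0 = 0` contributes nothing, so the first step relies on `h1` alone; afterwards the
    -- preceding denominator adds at least one.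
    rcases n with - | n
    · simp only [contDen] at h1 ⊢; omega
    · have := contDen_pos a (n := n) fun j h0 _ => ha j h0
      rw [contDen]
      omega

/-- In the fold the last entry may be replaced by any rational number, which an induction from the
end of the list needs. -/
theorem foldr_append_contFrac (l : List ℕ) (t : ℕ) :
    contFrac (l ++ [t]) = l.foldr (fun (b : ℕ) (z : ℚ) => b + 1 / z) t := by
  induction l with
  | nil => simp [contFrac]
  | cons b l ih =>
    rw [List.foldr_cons, ← ih]
    cases l <;> simp [contFrac]

/-- The continued fraction is a Möbius function of its tail z, with continuants as coefficients. In
the induction the last entry is absorbed into the tail as a + 1/z. -/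
theorem foldr_map_range (n : ℕ) {z : ℚ} (hz : 0 < z) :
    ((List.range (n + 1)).map a).foldr (fun (b : ℕ) (z : ℚ) => b + 1 / z) z
      = (contNum a (n + 1) * z + contNum a n) / (contDen a (n + 1) * z + contDen a n) := by
  induction n generalizing z with
  | zero => simp [contNum, contDen]; field_simp
  | succ n ih =>
    have hz' : (0 : ℚ) < a (n + 1) + 1 / z := by positivity
    rw [List.range_succ, List.map_append, List.foldr_append, List.map_singleton, List.foldr_cons,
      List.foldr_nil, ih hz']
    rw [← mul_div_mul_right _ _ hz.ne']
    simp only [contNum, contDen]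
    push_cast
    congr 1 <;> · field_simp; ring

theorem contFrac_map_range_append_one (n : ℕ) :
    contFrac ((List.range (n + 1)).map a ++ [1])
      = ((contNum a (n + 1) + contNum a n : ℕ) : ℚ) / (contDen a (n + 1) + contDen a n : ℕ) := by
  rw [foldr_append_contFrac, Nat.cast_one, foldr_map_range a n one_pos]
  push_cast
  simp

theorem contFrac_map_range {n : ℕ} (ha : n ≠ 0 → 1 ≤ a n) :
    contFrac ((List.range (n + 1)).map a) = (contNum a (n + 1) : ℚ) / contDen a (n + 1) := by
  rcases n with - | n
  · simp [contFrac, contNum, contDen]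
  · rw [List.range_succ, List.map_append, List.map_singleton, foldr_append_contFrac,
      foldr_map_range a n (by exact_mod_cast ha (by omega))]
    simp only [contNum, contDen]
    push_cast
    congr 1 <;> ring

end Continuants

/-! ### Runs of blowups of the same kind -/

section Runs

variable {k K Γ : Type*} [Field k] [Field K] [Algebra k K]
  [AddCommGroup Γ] [LinearOrder Γ] [IsOrderedAddMonoid Γ] {ν : AddValuation K (WithTop Γ)}
  {x y : K} {P : ℕ → K × K}

theorem lt_of_blowupKind_eq_x {p : K × K} (h : blowupKind ν p = .x) : ν p.1 < ν p.2 := by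
  unfold blowupKind at h
  split_ifs at h
  assumption

theorem lt_of_blowupKind_eq_y {p : K × K} (h : blowupKind ν p = .y) : ν p.2 < ν p.1 := by
  unfold blowupKind at h
  split_ifs at h
  assumption

theorem eq_of_blowupKind_eq_z {p : K × K} (h : blowupKind ν p = .z) : ν p.1 = ν p.2 := by
  unfold blowupKind at h
  split_ifs at h with h1 h2
  exact le_antisymm (not_lt.mp h2) (not_lt.mp h1)

namespace IsBlowupSequence

variable (hP : IsBlowupSequence k ν x y P)

include hP

theorem x_run {n t : ℕ} (h : ∀ s < t, blowupKind ν (P (n + s)) = .x) :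
    (P n).1 = (P (n + t)).1 ∧ (P n).2 = (P (n + t)).1 ^ t * (P (n + t)).2 := by
  induction t with
  | zero => simp
  | succ t ih =>
    obtain ⟨h1, h2⟩ := ih fun s hs => h s (by omega)
    obtain ⟨h3, h4⟩ := hP.x_blowup _ (lt_of_blowupKind_eq_x (h t (by omega)))
    rw [h1, h2, h4, h3]
    exact ⟨rfl, by rw [pow_succ, mul_assoc]; rfl⟩

theorem y_run {n t : ℕ} (h : ∀ s < t, blowupKind ν (P (n + s)) = .y) :
    (P n).2 = (P (n + t)).2 ∧ (P n).1 = (P (n + t)).1 * (P (n + t)).2 ^ t := by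
  induction t with
  | zero => simp
  | succ t ih =>
    obtain ⟨h1, h2⟩ := ih fun s hs => h s (by omega)
    obtain ⟨h3, h4⟩ := hP.y_blowup _ (lt_of_blowupKind_eq_y (h t (by omega)))
    rw [h1, h2, h4, h3]
    exact ⟨rfl, by rw [pow_succ', ← mul_assoc]; rfl⟩

theorem fst_ne_zero (hx : x ≠ 0) (n : ℕ) : (P n).1 ≠ 0 := by
  induction n with
  | zero => rw [hP.init]; exact hx
  | succ n ih =>
    rcases lt_trichotomy (ν (P n).1) (ν (P n).2) with h | h | h
    · rw [← (hP.x_blowup n h).1]; exact ih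
    · obtain ⟨c, -, -, h1, -⟩ := hP.z_blowup n h
      rw [← h1]; exact ih
    · rw [(hP.y_blowup n h).1] at ih
      exact left_ne_zero_of_mul ih

/-- For x- and y-blowups the new parameter has the difference of two distinct values; for a z-blowup
it is y/x - c, positive because c is the residue. -/
theorem pos (hx : x ≠ 0) (hx' : 0 < ν x) (hy' : 0 < ν y) (n : ℕ) :
    0 < ν (P n).1 ∧ 0 < ν (P n).2 := by
  induction n with
  | zero => rw [hP.init]; exact ⟨hx', hy'⟩
  | succ n ih =>
    rcases lt_trichotomy (ν (P n).1) (ν (P n).2) with h | h | h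
    · obtain ⟨h1, h2⟩ := hP.x_blowup n h
      refine ⟨h1 ▸ ih.1, WithTop.pos_of_eq_add ?_ h⟩
      rw [h2, ← h1, ν.map_mul]
    · obtain ⟨c, -, h0, h1, h2⟩ := hP.z_blowup n h
      refine ⟨h1 ▸ ih.1, ?_⟩
      have := hP.fst_ne_zero hx n
      rwa [h2, ← h1, mul_div_cancel_left₀ _ this, add_sub_cancel_right] at h0
    · obtain ⟨h1, h2⟩ := hP.y_blowup n h
      refine ⟨WithTop.pos_of_eq_add (a := ν (P n).2) (b := ν (P n).1) ?_ h, h2 ▸ ih.2⟩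
      rw [h1, ← h2, ν.map_mul, add_comm]

end IsBlowupSequence

/-! ### Parameters along a piece as monomials with continuant exponents. -/

namespace DualGraphData

variable (d : DualGraphData)

theorem sigma_add (i s t u : ℕ) : d.sigma i s (t + u) = d.sigma i s t + u := by
  simp [sigma, add_assoc]

theorem sigma_entry (i s : ℕ) : d.sigma i s (d.entry i (s + 1)) = d.sigma i (s + 1) 0 := by
  simp only [sigma]
  rw [Finset.sum_Icc_succ_top (by omega)]
  ring

theorem sigma_numSeg {i : ℕ} (hi : 1 ≤ i) : d.sigma i (d.numSeg i) 0 = d.sigma (i + 1) 0 0 := by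
  obtain ⟨j, rfl⟩ := Nat.exists_eq_add_of_le' hi
  simp only [sigma, Nat.add_sub_cancel]
  rw [Finset.sum_Icc_succ_top (a := 1) (b := j) (by omega)]
  simp

/-- The first `s` segments of the `i`-th piece are finite, nonempty and realized by blowups. -/
structure RealizesSegments (ν : AddValuation K (WithTop Γ)) (P : ℕ → K × K) (i s : ℕ) : Prop where
  one_le : ∀ j, 1 ≤ j → j ≤ s → 1 ≤ d.entry i j
  kind : ∀ j, 1 ≤ j → j ≤ s → ∀ t < d.entry i j,
    blowupKind ν (P (d.sigma i (j - 1) t)) = expectedKind i j t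

theorem entries_eq (i n : ℕ) : d.entries i n = (List.range n).map fun j => d.entry i (j + 1) := rfl

variable {d} {i s : ℕ}

theorem RealizesSegments.mono {s' : ℕ} (h : d.RealizesSegments ν P i s) (hs : s' ≤ s) :
    d.RealizesSegments ν P i s' :=
  ⟨fun j h1 h2 => h.one_le j h1 (h2.trans hs), fun j h1 h2 => h.kind j h1 (h2.trans hs)⟩

/-- The parameters at the end of the first segment. -/
theorem RealizesSegments.first (h : d.RealizesSegments ν P i 1)
    (hP : IsBlowupSequence k ν x y P) :
    (P (d.sigma i 0 1)).1 = (P (d.sigma i 1 0)).1 ∧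
      (P (d.sigma i 0 1)).2
        = (P (d.sigma i 1 0)).1 ^ (d.entry i 1 - 1) * (P (d.sigma i 1 0)).2 := by
  have h1 := h.one_le 1 le_rfl le_rfl
  -- Only a_1 - 1 blowups of the first segment remain at this level, and all are x-blowups: the
  -- possible z-blowup is the one already done.
  have hkind : ∀ t < d.entry i 1 - 1, blowupKind ν (P (d.sigma i 0 1 + t)) = .x := by
    intro t ht
    have := h.kind 1 le_rfl le_rfl (1 + t) (by omega)
    rw [Nat.sub_self, sigma_add] at this
    rw [this]
    simp [expectedKind]
  have := hP.x_run hkind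
  rwa [← sigma_add, show 1 + (d.entry i 1 - 1) = d.entry i (0 + 1) by rw [zero_add]; omega,
    sigma_entry, zero_add] at this

/-- The first parameters of a piece in terms of those after `r + 1` segments. -/
theorem RealizesSegments.eq_monomial (hP : IsBlowupSequence k ν x y P) {r : ℕ}
    (h : d.RealizesSegments ν P i (r + 1)) :
    (Even r →
      (P (d.sigma i 0 1)).1 = (P (d.sigma i (r + 1) 0)).1 ^ contDen (fun j => d.entry i (j + 1)) (r + 1)
        * (P (d.sigma i (r + 1) 0)).2 ^ contDen (fun j => d.entry i (j + 1)) r ∧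
      (P (d.sigma i 0 1)).1 * (P (d.sigma i 0 1)).2
        = (P (d.sigma i (r + 1) 0)).1 ^ contNum (fun j => d.entry i (j + 1)) (r + 1)
          * (P (d.sigma i (r + 1) 0)).2 ^ contNum (fun j => d.entry i (j + 1)) r) ∧
    (Odd r →
      (P (d.sigma i 0 1)).1 = (P (d.sigma i (r + 1) 0)).2 ^ contDen (fun j => d.entry i (j + 1)) (r + 1)
        * (P (d.sigma i (r + 1) 0)).1 ^ contDen (fun j => d.entry i (j + 1)) r ∧
      (P (d.sigma i 0 1)).1 * (P (d.sigma i 0 1)).2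
        = (P (d.sigma i (r + 1) 0)).2 ^ contNum (fun j => d.entry i (j + 1)) (r + 1)
          * (P (d.sigma i (r + 1) 0)).1 ^ contNum (fun j => d.entry i (j + 1)) r) := by
  induction r with
  | zero =>
    refine ⟨fun _ => ?_, fun h => absurd h (by simp)⟩
    obtain ⟨h1, h2⟩ := h.first hP
    obtain ⟨n, hn⟩ := Nat.exists_eq_add_of_le' (h.one_le 1 le_rfl le_rfl)
    rw [hn, Nat.add_sub_cancel] at h2
    simp only [zero_add, contNum, contDen, h1, h2, hn, pow_one, pow_zero, mul_one, true_and]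
    ring
  | succ r ih =>
    obtain ⟨ih1, ih2⟩ := ih (h.mono (by omega))
    have hkind := h.kind (r + 2) (by omega) le_rfl
    -- A run of a blowups of one kind acts on the exponents by the continuant recursion with entry
    -- a. Segments alternate in kind, so the parity of r decides which parameter carries the newer
    -- continuant.
    constructor
    · intro hr
      obtain ⟨e1, e2⟩ := ih2 (by grind)
      obtain ⟨h1, h2⟩ := hP.x_run (n := d.sigma i (r + 1) 0) (t := d.entry i (r + 2)) (by
        intro t ht
        rw [← sigma_add, zero_add]
        refine (hkind t ht).trans ?_
        have h1 : ¬ Even (r + 2) := by grind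
        simp [expectedKind, h1])
      rw [← sigma_add, zero_add, sigma_entry] at h1 h2
      rw [e2, e1, h1, h2]
      simp only [contNum, contDen]
      constructor <;> ring
    · intro hr
      obtain ⟨e1, e2⟩ := ih1 (by grind)
      obtain ⟨h1, h2⟩ := hP.y_run (n := d.sigma i (r + 1) 0) (t := d.entry i (r + 2)) (by
        intro t ht
        rw [← sigma_add, zero_add]
        refine (hkind t ht).trans ?_
        have h1 : Even (r + 2) := by grind
        simp [expectedKind, h1])
      rw [← sigma_add, zero_add, sigma_entry] at h1 h2
      rw [e2, e1, h1, h2]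
      simp only [contNum, contDen]
      constructor <;> ring

/-- In a piece with at least two segments, the first of them finite, the value of the second
parameter is not a multiple of the value of the first one. -/
theorem RealizesSegments.snd_ne_nsmul (h : d.RealizesSegments ν P i 1)
    (hP : IsBlowupSequence k ν x y P) (hx : x ≠ 0) (hx' : 0 < ν x) (hy' : 0 < ν y)
    (h2 : blowupKind ν (P (d.sigma i 1 0)) = .y) (n : ℕ) :
    ν (P (d.sigma i 0 1)).2 ≠ n • ν (P (d.sigma i 0 1)).1 := by
  obtain ⟨e1, e2⟩ := h.first hP
  have hlt := lt_of_blowupKind_eq_y h2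
  rw [e1, e2, ν.map_mul, ν.map_pow]
  have h1 := hP.pos hx hx' hy' (d.sigma i 1 0)
  have hne : ν (P (d.sigma i 1 0)).1 ≠ ⊤ := by rw [Ne, ν.top_iff]; exact hP.fst_ne_zero hx _
  generalize ν (P (d.sigma i 1 0)).1 = α at *
  generalize ν (P (d.sigma i 1 0)).2 = β at *
  generalize d.entry i 1 - 1 = m at *
  intro heq
  have hm := WithTop.nsmul_ne_top hne m
  -- The value m α + β with 0 < β < α lies strictly between two consecutive multiples of α.
  have lo : m < n := by
    rw [← WithTop.nsmul_lt_nsmul_iff_of_pos h1.1 hne, ← heq]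
    have := WithTop.add_lt_add_left hm h1.2
    rwa [add_zero] at this
  have hi : n < m + 1 := by
    rw [← WithTop.nsmul_lt_nsmul_iff_of_pos h1.1 hne, ← heq, succ_nsmul]
    exact WithTop.add_lt_add_left hm hlt
  omega

/-- If all blowups after the first one of a piece are `x`-blowups, the value of the second parameter
exceeds all multiples of the value of the first one. -/
theorem snd_ne_nsmul_of_x (hP : IsBlowupSequence k ν x y P) (hx : x ≠ 0) (hx' : 0 < ν x)
    (hy' : 0 < ν y) {m : ℕ} (h : ∀ t, blowupKind ν (P (m + t)) = .x) (n : ℕ) :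
    ν (P m).2 ≠ n • ν (P m).1 := by
  obtain ⟨e1, e2⟩ := hP.x_run (t := n) fun s _ => h s
  have hne : ν (P (m + n)).1 ≠ ⊤ := by rw [Ne, ν.top_iff]; exact hP.fst_ne_zero hx _
  rw [e1, e2, ν.map_mul, ν.map_pow]
  have := WithTop.add_lt_add_left (WithTop.nsmul_ne_top hne n) (hP.pos hx hx' hy' (m + n)).2
  rw [add_zero] at this
  exact this.ne'

theorem den_betaPrime_eq {i r : ℕ} (hr : d.numSeg i = r + 2) {p q : ℕ}
    (hp : p = contNum (fun j => d.entry i (j + 1)) (r + 2) + contNum (fun j => d.entry i (j + 1)) (r + 1))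
    (hq : q = contDen (fun j => d.entry i (j + 1)) (r + 2) + contDen (fun j => d.entry i (j + 1)) (r + 1))
    (hcop : Nat.Coprime p q) (hq0 : 0 < q) :
    d.betaPrime i = (p : ℚ) / q ∧ (d.betaPrime i).den = q := by
  have h : d.betaPrime i = (p : ℚ) / q := by
    rw [betaPrime, entries_eq, hr, contFrac_map_range_append_one _ (r + 1), hp, hq]
  refine ⟨h, ?_⟩
  have := Rat.den_div_eq_of_coprime (a := p) (b := q) (by exact_mod_cast hq0) (by simpa using hcop)
  rw [Int.cast_natCast, Int.cast_natCast, Int.natCast_inj] at this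
  rw [h, this]

/-- The transformation of the parameters along a whole piece. -/
theorem exists_piece_step (hi : 1 ≤ i) (hP : IsBlowupSequence k ν x y P)
    (hm : 2 ≤ d.numSeg i) (h : d.RealizesSegments ν P i (d.numSeg i))
    (hz : blowupKind ν (P (d.sigma (i + 1) 0 0)) = .z) :
    ∃ (p b e : ℕ) (c : k), c ≠ 0 ∧ 2 ≤ d.q i ∧ d.q i * e = b * p + 1 ∧
      d.betaPrime i = (p : ℚ) / d.q i ∧
      (P (d.sigma i 0 1)).1 = (P (d.sigma (i + 1) 0 1)).1 ^ d.q i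
        * ((P (d.sigma (i + 1) 0 1)).2 + algebraMap k K c) ^ b ∧
      (P (d.sigma i 0 1)).1 * (P (d.sigma i 0 1)).2 = (P (d.sigma (i + 1) 0 1)).1 ^ p
        * ((P (d.sigma (i + 1) 0 1)).2 + algebraMap k K c) ^ e := by
  obtain ⟨r, hr⟩ := Nat.exists_eq_add_of_le' hm
  have hmon := (hr ▸ h).eq_monomial hP
  obtain ⟨c, hc, -, hz1, hz2⟩ := hP.z_blowup _ (eq_of_blowupKind_eq_z hz)
  rw [← sigma_add, zero_add] at hz1 hz2
  rw [show r + 1 + 1 = d.numSeg i from hr.symm, sigma_numSeg d hi, hr] at hmon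
  set a : ℕ → ℕ := fun j => d.entry i (j + 1) with ha
  have ha1 : ∀ j, j ≠ 0 → j ≤ r + 1 → 1 ≤ a j := fun j _ hj => h.one_le (j + 1) (by omega) (by omega)
  have hk1 := contDen_pos a (n := r) fun j h0 hj => ha1 j h0 (by omega)
  have hk2 : 1 ≤ contDen a (r + 2) := contDen_pos a (n := r + 1) ha1
  -- The z-blowup turns x_n, y_n into X', X' U, so their exponents add up in X'. This is the effect
  -- of the final entry 1 in β'.
  obtain ⟨p, hp⟩ : ∃ p, p = contNum a (r + 2) + contNum a (r + 1) := ⟨_, rfl⟩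
  obtain ⟨q, hq⟩ : ∃ q, q = contDen a (r + 2) + contDen a (r + 1) := ⟨_, rfl⟩
  suffices H : ∃ b e, q * e = b * p + 1 ∧
      (P (d.sigma i 0 1)).1 = (P (d.sigma (i + 1) 0 1)).1 ^ q
        * ((P (d.sigma (i + 1) 0 1)).2 + algebraMap k K c) ^ b ∧
      (P (d.sigma i 0 1)).1 * (P (d.sigma i 0 1)).2 = (P (d.sigma (i + 1) 0 1)).1 ^ p
        * ((P (d.sigma (i + 1) 0 1)).2 + algebraMap k K c) ^ e by
    obtain ⟨b, e, hdet, h1, h2⟩ := H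
    have hcop : Nat.Coprime p q := by
      refine Nat.Coprime.symm (Nat.Coprime.of_dvd (Dvd.intro e rfl) (Dvd.intro_left b rfl) ?_)
      rw [hdet]; simp
    obtain ⟨hb, hden⟩ := den_betaPrime_eq hr hp hq hcop (by omega)
    have hqi : d.q i = q := by rw [DualGraphData.q, if_neg (by omega), hden]
    rw [hqi]
    exact ⟨p, b, e, c, hc, by omega, hdet, hb, h1, h2⟩
  -- The exponents b and e of U are those of the old second parameter: the older continuants or the
  -- newer ones, according to parity.
  rcases Nat.even_or_odd (r + 1) with hev | hodd
  · obtain ⟨e1, e2⟩ := hmon.1 hev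
    have hdet := (cont_det_of_even a hev).1
    refine ⟨contDen a (r + 1), contNum a (r + 1), ?_, ?_, ?_⟩
    · rw [hp, hq]; linarith
    · rw [e1, hz1, hz2, hq, mul_pow]; ring
    · rw [e2, hz1, hz2, hp, mul_pow]; ring
  · obtain ⟨e1, e2⟩ := hmon.2 hodd
    obtain ⟨s, hs⟩ := hodd
    have hdet := (cont_det_of_even a (even_two_mul s)).2
    rw [show 2 * s + 1 = r + 1 from hs.symm, show 2 * s + 2 = r + 2 by omega] at hdet
    refine ⟨contDen a (r + 2), contNum a (r + 2), ?_, ?_, ?_⟩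
    · rw [hp, hq]; linarith
    · rw [e1, hz1, hz2, hq, mul_pow]; ring
    · rw [e2, hz1, hz2, hp, mul_pow]; ring

end DualGraphData

end Runs

/-! ### The values of a minimal generating sequence -/

section Values

variable {k R K Γ : Type*} [Field k] [CommRing R] [IsLocalRing R] [Field K]
  [Algebra k R] [Algebra R K] [Algebra k K]
  [AddCommGroup Γ] [LinearOrder Γ] [IsOrderedAddMonoid Γ] {ν : AddValuation K (WithTop Γ)}

/-- Both c and its inverse come from R, so two nonnegative values add up to 0. -/
theorem IsCenteredOn.map_algebraMap_eq_zero [IsScalarTower k R K] (h : IsCenteredOn R ν) (c : k)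
    (hc : c ≠ 0) : ν (algebraMap k K c) = 0 := by
  have h1 : ∀ c : k, 0 ≤ ν (algebraMap k K c) := fun c => by
    rw [IsScalarTower.algebraMap_apply k R K]
    exact h.nonneg _
  refine le_antisymm ?_ (h1 c)
  have h2 := add_le_add (le_refl (ν (algebraMap k K c))) (h1 c⁻¹)
  rwa [← ν.map_mul, ← map_mul, mul_inv_cancel₀ hc, map_one, ν.map_one, add_zero] at h2

omit [Algebra k K] in
/-- In a minimal generating sequence no value lies in the semigroup of the preceding ones. -/
theorem IsMinimalGeneratingSequence.notMem_partialSemigroup {d : DualGraphData} {x y : R} {g' : ℕ∞}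
    {Q : ℕ → R} (h : IsMinimalGeneratingSequence k d ν x y g' Q) {i : ℕ} (hi : (i : ℕ∞) ≤ g') :
    ν (algebraMap R K (Q i)) ∉ partialSemigroup ν (fun j => algebraMap R K (Q j)) i := by
  intro hmem
  refine h.minimal i hi ?_
  rw [h.generates]
  congr 1
  refine le_antisymm ?_ (AddSubsemigroup.closure_mono fun _ ⟨j, h1, _, h2⟩ => ⟨j, h1, h2⟩)
  rw [AddSubsemigroup.closure_le]
  rintro _ ⟨j, h1, rfl⟩
  rcases eq_or_ne j i with rfl | hj
  · refine AddSubsemigroup.closure_mono ?_ hmem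
    rintro _ ⟨l, hl, rfl⟩
    exact ⟨l, le_trans (by exact_mod_cast hl.le) h1, hl.ne, rfl⟩
  · exact AddSubsemigroup.subset_closure ⟨j, h1, hj, rfl⟩

-- Members of a generating sequence have values attained by nonzero elements of R. Through the
-- recursion this excludes ν(Y) = ⊤ in Types 2 and 4.2.
omit [Algebra k K] in
theorem IsMinimalGeneratingSequence.map_ne_top [IsDomain R] [IsFractionRing R K] {d : DualGraphData}
    {x y : R} {g' : ℕ∞} {Q : ℕ → R} (h : IsMinimalGeneratingSequence k d ν x y g' Q) {i : ℕ}
    (hi : (i : ℕ∞) ≤ g') : ν (algebraMap R K (Q i)) ≠ ⊤ := by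
  have : ν (algebraMap R K (Q i)) ∈ valueSemigroup R ν := by
    rw [h.generates]
    exact AddSubsemigroup.subset_closure ⟨i, hi, rfl⟩
  obtain ⟨f, -, hf, e⟩ := this
  rw [← e, Ne, ν.top_iff]
  simpa using hf

namespace DualGraphData

variable {d : DualGraphData} {P : ℕ → K × K} {i : ℕ}

/-- The `i`-th piece is finite, realized by blowups, and followed by a `z`-blowup. -/
structure IsCompletePiece (d : DualGraphData) (ν : AddValuation K (WithTop Γ)) (P : ℕ → K × K)
    (i : ℕ) : Prop where
  two_le : 2 ≤ d.numSeg i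
  segments : d.RealizesSegments ν P i (d.numSeg i)
  z_blowup : blowupKind ν (P (d.sigma (i + 1) 0 0)) = .z

theorem RealizesPiece.realizesSegments (h : d.RealizesPiece ν P i) {s : ℕ} (hs : (s : ℕ∞) ≤ d.m i)
    (h1 : ∀ j, 1 ≤ j → j ≤ s → 1 ≤ d.a i j) (h2 : ∀ j, 1 ≤ j → j ≤ s → d.a i j ≠ ⊤) :
    d.RealizesSegments ν P i s where
  one_le j hj hj' := by
    have h3 := h1 j hj hj'
    rw [← ENat.natCast_toNat (h2 j hj hj')] at h3
    exact_mod_cast h3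
  kind j hj hj' t ht := by
    refine h j hj (le_trans (by exact_mod_cast hj') hs) t ?_
    rw [← ENat.natCast_toNat (h2 j hj hj')]
    exact_mod_cast ht

theorem FinitePiece.coe_numSeg (h : d.FinitePiece i) : (d.numSeg i : ℕ∞) = d.m i :=
  ENat.natCast_toNat h.m_ne_top

theorem FinitePiece.isCompletePiece (h : d.FinitePiece i) (hr : d.RealizesPiece ν P i)
    (hz : blowupKind ν (P (d.sigma (i + 1) 0 0)) = .z) : d.IsCompletePiece ν P i where
  two_le := by
    have := h.two_le
    rw [← h.coe_numSeg] at this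
    exact_mod_cast this
  segments := hr.realizesSegments h.coe_numSeg.le
    (fun j h1 h2 => h.one_le j h1 (h.coe_numSeg ▸ by exact_mod_cast h2))
    (fun j h1 h2 => h.a_ne_top j h1 (h.coe_numSeg ▸ by exact_mod_cast h2))
  z_blowup := hz

theorem RealizesPiece.kind_first (h : d.RealizesPiece ν P i) (hm : 1 ≤ d.m i) (ha : 1 ≤ d.a i 1) :
    blowupKind ν (P (d.sigma i 0 0)) = if 2 ≤ i then .z else .x := by
  have h1 := h 1 le_rfl (by exact_mod_cast hm) 0 (lt_of_lt_of_le (by norm_num) ha)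
  rw [h1]
  simp [expectedKind]

theorem RealizesPiece.kind_second (h : d.RealizesPiece ν P i) (hm : 2 ≤ d.m i) (ha : 1 ≤ d.a i 2) :
    blowupKind ν (P (d.sigma i 1 0)) = .y := by
  have h1 := h 2 (by omega) (by exact_mod_cast hm) 0 (lt_of_lt_of_le (by norm_num) ha)
  rw [h1]
  simp [expectedKind]

theorem IsCompletePiece.kind_second (h : d.IsCompletePiece ν P i) :
    blowupKind ν (P (d.sigma i 1 0)) = .y := by
  rw [h.segments.kind 2 (by omega) h.two_le 0 (h.segments.one_le 2 (by omega) h.two_le)]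
  simp [expectedKind]

end DualGraphData

open DualGraphData

variable {d : DualGraphData} {P : ℕ → K × K} {x y : R} {Q : ℕ → R} {g' : ℕ∞}

/-- The value of `x` in terms of the value of the first parameter of the `i`-th piece. -/
theorem map_eq_qProd_nsmul [IsScalarTower k R K] (hν : IsCenteredOn R ν) {x y : K}
    (hP : IsBlowupSequence k ν x y P) (hx : x ≠ 0) (hx' : 0 < ν x) (hy' : 0 < ν y)
    (h0 : blowupKind ν (P 0) = .x) (n : ℕ) (hc : ∀ i, 1 ≤ i → i ≤ n → d.IsCompletePiece ν P i) :
    ν x = d.qProd n • ν (P (d.sigma (n + 1) 0 1)).1 := by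
  induction n with
  | zero =>
    have := (hP.x_blowup 0 (lt_of_blowupKind_eq_x h0)).1
    rw [hP.init] at this
    simp only [] at this
    rw [this]
    simp [qProd, sigma]
  | succ n ih =>
    rw [ih fun i h1 h2 => hc i h1 (by omega)]
    have hcn := hc (n + 1) (by omega) le_rfl
    obtain ⟨p, b, e, c, hc0, -, -, -, e1, -⟩ :=
      exists_piece_step (by omega) hP hcn.two_le hcn.segments hcn.z_blowup
    have hU : ν ((P (d.sigma (n + 1 + 1) 0 1)).2 + algebraMap k K c) = 0 := by
      rw [add_comm]
      exact AddValuation.map_add_eq_zero_of_pos (hν.map_algebraMap_eq_zero c hc0)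
        (hP.pos hx hx' hy' _).2
    rw [e1, ν.map_mul, ν.map_pow, ν.map_pow, hU, nsmul_zero, add_zero, smul_smul]
    congr 1
    rw [qProd, qProd, Finset.prod_Icc_succ_top (by omega)]

/-- The parameters at the beginning of each piece are adapted to a minimal generating sequence. -/
theorem exists_isAdapted [IsScalarTower k R K] (hν : IsCenteredOn R ν)
    (hP : IsBlowupSequence k ν (algebraMap R K x) (algebraMap R K y) P)
    (hQ : IsMinimalGeneratingSequence k d ν x y g' Q) (hx : algebraMap R K x ≠ 0)
    (hx' : 0 < ν (algebraMap R K x)) (hy' : 0 < ν (algebraMap R K y))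
    (h0 : blowupKind ν (P 0) = .x) {n : ℕ} (hn : (n : ℕ∞) ≤ g')
    (hc : ∀ i, 1 ≤ i → i < n → d.IsCompletePiece ν P i)
    (hnon : ∀ m : ℕ, ν (P (d.sigma n 0 1)).2 ≠ m • ν (P (d.sigma n 0 1)).1) (h1n : 1 ≤ n) :
    ∃ M, IsAdapted k ν (fun j => algebraMap R K (Q j)) n (d.q (n - 1))
      (P (d.sigma n 0 1)).1 (P (d.sigma n 0 1)).2 M := by
  induction n, h1n using Nat.le_induction with
  | base =>
    obtain ⟨e1, e2⟩ := hP.x_blowup 0 (lt_of_blowupKind_eq_x h0)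
    rw [hP.init] at e1 e2
    simp only [zero_add] at e1 e2
    have hs : d.sigma 1 0 1 = 1 := by simp [sigma]
    rw [hs]
    have hpos := hP.pos hx hx' hy' 1
    have hQ0 : algebraMap R K (Q 0) = (P 1).1 := by rw [hQ.zero, e1]
    -- After the first x-blowup Q_0 = X and Q_1 = XY, so M = 1 and h = 0; the convention q_0 = 1
    -- fits.
    refine ⟨1, hP.fst_ne_zero hx 1, hpos.1, hpos.2, le_rfl, ?_, ?_, ?_, ?_⟩
    · intro j hj
      obtain rfl : j = 0 := by omega
      exact ⟨1, 1, .one, by rw [hQ0, pow_one, mul_one]⟩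
    · refine ⟨1, 0, .one, .zero, ?_, by rw [mul_zero, add_zero]⟩
      rw [hQ.one, e2]
      ring
    · simp [q, hQ0]
    · intro m hm
      obtain ⟨m, rfl⟩ := Nat.exists_eq_add_of_le' hm
      rw [← hQ0]
      exact AddSubsemigroup.succ_nsmul_mem _ (mem_partialSemigroup (Q := fun j => algebraMap R K (Q j))
        zero_lt_one) m
  | succ i hi ih =>
    have hci := hc i hi (by omega)
    obtain ⟨M, hA⟩ := ih (le_trans (by exact_mod_cast Nat.le_succ i) hn)
      (fun j h1 h2 => hc j h1 (by omega))
      ((hci.segments.mono (by have := hci.two_le; omega)).snd_ne_nsmul hP hx hx' hy' hci.kind_second)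
    obtain ⟨p, b, e, c, hc0, hq, hdet, -, e1, e2⟩ :=
      exists_piece_step hi hP hci.two_le hci.segments hci.z_blowup
    obtain ⟨δ, u, γ, -, -, hval, hrec⟩ := hQ.recur (i + 1) (by omega) hn
    have hpos := hP.pos hx hx' hy' (d.sigma (i + 1) 0 1)
    refine hA.succ (u := u) (fun c hc => hν.map_algebraMap_eq_zero c hc) hc0 hpos.1 hpos.2 e1 e2 hdet hq hnon
      hval ?_ (hQ.notMem_partialSemigroup hn)
    rw [hrec, map_sub, map_pow, map_sum]
    congr 1
    refine Finset.sum_congr rfl fun h _ => ?_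
    rw [map_mul, map_prod, ← IsScalarTower.algebraMap_apply]
    simp_rw [map_pow]
    rfl

/-- The recursive formula for a piece which is followed by a `z`-blowup. -/
theorem standardValue_of_isAdapted [Module ℚ Γ] [IsScalarTower k R K] (hν : IsCenteredOn R ν)
    (hP : IsBlowupSequence k ν (algebraMap R K x) (algebraMap R K y) P)
    (hx' : 0 < ν (algebraMap R K x)) (hy' : 0 < ν (algebraMap R K y)) {β₀ : Γ}
    (hβ : ν (algebraMap R K x) = β₀) (h0 : blowupKind ν (P 0) = .x) {i M : ℕ} (hi : 1 ≤ i)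
    (hc : ∀ j, 1 ≤ j → j ≤ i → d.IsCompletePiece ν P j)
    (hA : IsAdapted k ν (fun j => algebraMap R K (Q j)) i (d.q (i - 1))
      (P (d.sigma i 0 1)).1 (P (d.sigma i 0 1)).2 M) : StandardValue d ν Q β₀ i := by
  rw [StandardValue, hA.value_eq]
  congr 1
  have hx : algebraMap R K x ≠ 0 := by rw [← ν.ne_top_iff, hβ]; exact WithTop.coe_ne_top
  have hci := hc i hi le_rfl
  obtain ⟨p, b, e, c, hc0, hq, -, hbeta, e1, e2⟩ :=
    exists_piece_step hi hP hci.two_le hci.segments hci.z_blowup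
  have hprod := map_eq_qProd_nsmul hν hP hx hx' hy' h0 (i - 1)
    fun j h1 h2 => hc j h1 (by omega)
  rw [Nat.sub_add_cancel hi, hβ] at hprod
  have hU : ν ((P (d.sigma (i + 1) 0 1)).2 + algebraMap k K c) = 0 := by
    rw [add_comm]
    exact AddValuation.map_add_eq_zero_of_pos (hν.map_algebraMap_eq_zero c hc0)
      (hP.pos hx hx' hy' _).2
  have hξ : ν (P (d.sigma (i + 1) 0 1)).1 ≠ ⊤ := by rw [Ne, ν.top_iff]; exact hP.fst_ne_zero hx _
  have hX : ν (P (d.sigma i 0 1)).1 = d.q i • ν (P (d.sigma (i + 1) 0 1)).1 := by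
    rw [e1, ν.map_mul, ν.map_pow, ν.map_pow, hU, nsmul_zero, add_zero]
  have hXY : ν (P (d.sigma i 0 1)).1 + ν (P (d.sigma i 0 1)).2
      = p • ν (P (d.sigma (i + 1) 0 1)).1 := by
    rw [← ν.map_mul, e2, ν.map_mul, ν.map_pow, ν.map_pow, hU, nsmul_zero, add_zero]
  have hY : ν (P (d.sigma i 0 1)).2 ≠ ⊤ := by
    intro h
    rw [h, add_top] at hXY
    exact WithTop.nsmul_ne_top hξ p hXY.symm
  rw [hX] at hprod hXY
  generalize ν (P (d.sigma (i + 1) 0 1)).1 = ξ at *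
  generalize ν (P (d.sigma i 0 1)).2 = η at *
  lift ξ to Γ using hξ
  lift η to Γ using hY
  norm_cast at hprod hXY ⊢
  -- Now ν(Y) = (p - q_i) ξ and β₀ = q_1 ⋯ q_i ξ; eliminating ξ gives the factor (p/q_i - 1) / (q_1
  -- ⋯ q_{i-1}).
  have hη : η = (p : ℚ) • ξ - (d.q i : ℚ) • ξ := by
    rw [Nat.cast_smul_eq_nsmul, Nat.cast_smul_eq_nsmul, ← hXY]; abel
  have hqp : (d.qProd (i - 1) : ℚ) ≠ 0 := by
    intro h
    rw [Nat.cast_eq_zero] at h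
    rw [h, zero_smul] at hprod
    rw [hβ, hprod] at hx'
    exact lt_irrefl _ hx'
  have hqi : (d.q i : ℚ) ≠ 0 := by positivity
  rw [hη, hprod, hbeta, ← sub_smul, ← Nat.cast_smul_eq_nsmul ℚ, ← Nat.cast_smul_eq_nsmul ℚ,
    smul_smul, smul_smul]
  congr 1
  field_simp

end Values

/-! ### Convergents of infinite continued fractions -/

open DualGraphData

/-- By the determinant identity the expression is β or -β, and ξ exceeds its summand `contDen a r *
β`. -/
theorem abs_mul_contDen_sub_lt (a : ℕ → ℕ) (ha : ∀ j, j ≠ 0 → 1 ≤ a j) (r : ℕ) {ξ ζ α β : ℝ}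
    (hα : 0 < α) (hβ : 0 < β) (hξ : ξ = contDen a (r + 1) * α + contDen a r * β)
    (hζ : ζ = contNum a (r + 1) * α + contNum a r * β) :
    ζ * contDen a (r + 1) - ξ * contNum a (r + 1) ≠ 0 ∧
      contDen a r * |ζ * contDen a (r + 1) - ξ * contNum a (r + 1)| < ξ := by
  have key : |ζ * contDen a (r + 1) - ξ * contNum a (r + 1)| = β := by
    rcases Nat.even_or_odd r with hr | ⟨s, rfl⟩
    · have h : (contNum a r * contDen a (r + 1) : ℝ) = contDen a r * contNum a (r + 1) + 1 := by
        exact_mod_cast (cont_det_of_even a hr).1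
      rw [show ζ * contDen a (r + 1) - ξ * contNum a (r + 1) = β by
        rw [hζ, hξ]; linear_combination β * h, abs_of_pos hβ]
    · have h : (contDen a (2 * s + 1) * contNum a (2 * s + 2) : ℝ)
          = contNum a (2 * s + 1) * contDen a (2 * s + 2) + 1 := by
        exact_mod_cast (cont_det_of_even a (even_two_mul s)).2
      rw [show ζ * contDen a (2 * s + 1 + 1) - ξ * contNum a (2 * s + 1 + 1) = -β by
        rw [hζ, hξ]; linear_combination -β * h, abs_neg, abs_of_pos hβ]
  rw [key]
  constructor
  · intro h
    rw [h, abs_zero] at key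
    exact hβ.ne key
  · have : (1 : ℝ) ≤ contDen a (r + 1) := by
      exact_mod_cast contDen_pos a fun j h0 _ => ha j h0
    rw [hξ]
    nlinarith

/-- If `ξ` and `ζ` are positive combinations of consecutive continuants at each stage, the convergents
tend to `ζ / ξ`, which is irrational. -/
theorem irrational_and_tendsto_convergents (a : ℕ → ℕ) (ha : ∀ j, j ≠ 0 → 1 ≤ a j) {ξ ζ : ℝ}
    (hξ : 0 < ξ) (H : ∀ r, ∃ α β : ℝ, 0 < α ∧ 0 < β ∧
      ξ = contDen a (r + 1) * α + contDen a r * β ∧ ζ = contNum a (r + 1) * α + contNum a r * β) :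
    Irrational (ζ / ξ) ∧
      Filter.Tendsto (fun r => (contNum a (r + 1) / contDen a (r + 1) : ℝ)) Filter.atTop
        (nhds (ζ / ξ)) := by
  have H' : ∀ r, ζ * contDen a (r + 1) - ξ * contNum a (r + 1) ≠ 0 ∧
      contDen a r * |ζ * contDen a (r + 1) - ξ * contNum a (r + 1)| < ξ := fun r => by
    obtain ⟨α, β, hα, hβ, h1, h2⟩ := H r
    exact abs_mul_contDen_sub_lt a ha r hα hβ h1 h2
  constructor
  · rintro ⟨z, hz⟩
    -- At this index the denominator `contDen a (z.den + 1)` is at least `z.den`. Then |D| · `z.den`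
    -- would be less than ξ, although it is a nonzero integral multiple of ξ.
    obtain ⟨h1, h2⟩ := H' (z.den + 1)
    have hden : (0 : ℝ) < z.den := by exact_mod_cast z.den_pos
    have hζ : ζ * z.den = ξ * z.num := by
      have : (z : ℝ) * z.den = z.num := by exact_mod_cast Rat.mul_den_eq_num z
      rw [eq_div_iff hξ.ne'] at hz
      rw [← hz, ← this]; ring
    set D := ζ * contDen a (z.den + 1 + 1) - ξ * contNum a (z.den + 1 + 1) with hD
    set w : ℤ := z.num * contDen a (z.den + 1 + 1) - z.den * contNum a (z.den + 1 + 1) with hw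
    have e : D * z.den = ξ * w := by
      rw [hD, hw]
      push_cast
      linear_combination (contDen a (z.den + 1 + 1) : ℝ) * hζ
    have hw0 : w ≠ 0 := by
      intro h
      rw [h, Int.cast_zero, mul_zero, mul_eq_zero] at e
      exact e.elim h1 hden.ne'
    have hw1 : (1 : ℝ) ≤ |(w : ℝ)| := by exact_mod_cast Int.one_le_abs hw0
    have e2 : |D| * z.den = ξ * |(w : ℝ)| := by
      rw [← abs_of_pos hden, ← abs_mul, e, abs_mul, abs_of_pos hξ]
    have hk : (z.den : ℝ) ≤ contDen a (z.den + 1) := by exact_mod_cast le_contDen a ha z.den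
    have h3 : z.den * |D| ≤ contDen a (z.den + 1) * |D| := by gcongr
    nlinarith
  · rw [tendsto_iff_dist_tendsto_zero]
    refine squeeze_zero' (Filter.Eventually.of_forall fun _ => dist_nonneg) ?_
      tendsto_one_div_atTop_nhds_zero_nat
    filter_upwards [Filter.eventually_ge_atTop 1] with r hr
    obtain ⟨-, h2⟩ := H' r
    obtain ⟨s, rfl⟩ := Nat.exists_eq_add_of_le' hr
    have hk1 : (1 : ℝ) ≤ contDen a (s + 1) := by
      exact_mod_cast contDen_pos a fun j h0 _ => ha j h0
    have hk2 : (1 : ℝ) ≤ contDen a (s + 1 + 1) := by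
      exact_mod_cast contDen_pos a fun j h0 _ => ha j h0
    have hk3 : ((s + 1 : ℕ) : ℝ) ≤ contDen a (s + 1 + 1) := by exact_mod_cast le_contDen a ha (s + 1)
    have hs : (0 : ℝ) < ((s + 1 : ℕ) : ℝ) := by positivity
    have h3 : |ζ * contDen a (s + 1 + 1) - ξ * contNum a (s + 1 + 1)| < ξ :=
      lt_of_le_of_lt (le_mul_of_one_le_left (abs_nonneg _) hk1) h2
    have hk0 : (0 : ℝ) < contDen a (s + 1 + 1) := by linarith
    rw [Real.dist_eq, abs_sub_comm, div_sub_div _ _ hξ.ne' hk0.ne', abs_div, abs_of_pos (mul_pos hξ hk0),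
      div_le_div_iff₀ (mul_pos hξ hk0) hs, one_mul]
    calc _ ≤ ξ * ((s + 1 : ℕ) : ℝ) := by gcongr
      _ ≤ _ := by gcongr

namespace DualGraphData

variable {d : DualGraphData} {i : ℕ}

theorem convergent_succ_eq {n : ℕ} (h : n ≠ 0 → 1 ≤ d.entry i (n + 1)) :
    d.convergent i (n + 1) = (contNum (fun j => d.entry i (j + 1)) (n + 1) : ℚ)
      / contDen (fun j => d.entry i (j + 1)) (n + 1) := by
  rw [convergent, entries_eq]
  exact contFrac_map_range (fun j => d.entry i (j + 1)) h

/-- The numerators and denominators of the convergents are the continuants. -/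
theorem lam_mu_eq {n : ℕ} (h : ∀ j, 1 ≤ j → j ≤ n → 1 ≤ d.entry i j) :
    d.lam i n = contNum (fun j => d.entry i (j + 1)) n ∧
      d.mu i n = contDen (fun j => d.entry i (j + 1)) n := by
  rcases n with - | n
  · simp [lam, mu, contNum, contDen]
  · have hpos := contDen_pos (fun j => d.entry i (j + 1)) (n := n)
      fun j _ hj => h (j + 1) (by omega) (by omega)
    have hcop := cont_coprime (fun j => d.entry i (j + 1)) n
    have hconv := convergent_succ_eq (d := d) (i := i) (n := n)
      fun _ => h (n + 1) (by omega) le_rfl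
    generalize contNum (fun j => d.entry i (j + 1)) (n + 1) = a at *
    generalize contDen (fun j => d.entry i (j + 1)) (n + 1) = b at *
    have h1 := Rat.num_div_eq_of_coprime (a := a) (b := b) (by exact_mod_cast hpos)
      (by simpa using hcop)
    have h2 := Rat.den_div_eq_of_coprime (a := a) (b := b) (by exact_mod_cast hpos)
      (by simpa using hcop)
    rw [Int.cast_natCast, Int.cast_natCast] at h1 h2
    rw [Int.natCast_inj] at h2
    simp [lam, mu, hconv, h1, h2]

end DualGraphData

/-! ### First components of values in rank two. -/

section RankTwo

variable {R K : Type*} [CommRing R] [IsLocalRing R] [Field K] [Algebra R K]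

/-- Elements of `ℚ²` whose first component is an integral multiple of `a`. -/
def firstMultiples (a : ℚ) : AddSubsemigroup (WithTop (ℚ ×ₗ ℚ)) where
  carrier := {γ | ∃ (c : ℤ) (r : ℚ), γ = (toLex (c * a, r) : ℚ ×ₗ ℚ)}
  add_mem' := by
    rintro _ _ ⟨c, r, rfl⟩ ⟨c', r', rfl⟩
    refine ⟨c + c', r + r', ?_⟩
    rw [← WithTop.coe_add, ← toLex_add, Prod.mk_add_mk]
    push_cast
    rw [add_mul]

/-- If the value semigroup lies in `firstMultiples a`, so does the value group. -/
theorem map_mem_firstMultiples [IsDomain R] [IsFractionRing R K]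
    {ν : AddValuation K (WithTop (ℚ ×ₗ ℚ))} (hν : IsCenteredOn R ν) {a : ℚ}
    (h : valueSemigroup R ν ⊆ firstMultiples a) {f : K} (hf : f ≠ 0) :
    ν f ∈ firstMultiples a := by
  have hR : ∀ g : R, g ≠ 0 → ν (algebraMap R K g) ∈ firstMultiples a := by
    intro g hg
    by_cases hgm : g ∈ maximalIdeal R
    · exact h ⟨g, hgm, hg, rfl⟩
    · have h0 : ν (algebraMap R K g) = 0 :=
        le_antisymm (not_lt.mp fun hlt => hgm ((hν.pos_iff g).mp hlt)) (hν.nonneg g)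
      rw [h0]
      exact ⟨0, 0, by rw [Int.cast_zero, zero_mul]; rfl⟩
  obtain ⟨r, s, hs, rfl⟩ := IsFractionRing.div_surjective (A := R) f
  have hs0 : s ≠ 0 := nonZeroDivisors.ne_zero hs
  have hr0 : r ≠ 0 := by rintro rfl; simp at hf
  obtain ⟨c, u, e⟩ := hR r hr0
  obtain ⟨c', u', e'⟩ := hR s hs0
  refine ⟨c - c', u - u', ?_⟩
  have hsK : algebraMap R K s ≠ 0 := by simpa using hs0
  have hfin : ν (algebraMap R K r / algebraMap R K s) ≠ ⊤ := by rwa [Ne, ν.top_iff]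
  have hmul : ν (algebraMap R K r / algebraMap R K s) + ν (algebraMap R K s)
      = ν (algebraMap R K r) := by
    rw [← ν.map_mul, div_mul_cancel₀ _ hsK]
  rw [e, e'] at hmul
  generalize ν (algebraMap R K r / algebraMap R K s) = γ at *
  lift γ to ℚ ×ₗ ℚ using hfin
  rw [← WithTop.coe_add, WithTop.coe_inj, ← eq_sub_iff_add_eq, ← toLex_sub, Prod.mk_sub_mk] at hmul
  rw [hmul]
  push_cast
  rw [sub_mul]

end RankTwo

/-! ### The formulas for each type of valuation. -/

section Types

open DualGraphData

variable {k R K Γ : Type*} [Field k] [CommRing R] [IsLocalRing R] [Field K]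
  [Algebra k R] [Algebra R K] [Algebra k K]
  [AddCommGroup Γ] [LinearOrder Γ] [IsOrderedAddMonoid Γ]
  {d : DualGraphData} {P : ℕ → K × K} {x y : R} {Q : ℕ → R} {n : ℕ}

theorem IsCenteredOn.pos_of_eq_span {ν : AddValuation K (WithTop Γ)} (hν : IsCenteredOn R ν)
    (hxy : maximalIdeal R = Ideal.span {x, y}) :
    0 < ν (algebraMap R K x) ∧ 0 < ν (algebraMap R K y) := by
  rw [hν.pos_iff, hν.pos_iff, hxy]
  exact ⟨Ideal.subset_span (by simp), Ideal.subset_span (by simp)⟩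

theorem AddValuation.ne_zero_of_map_eq_coe {ν : AddValuation K (WithTop Γ)} {f : K} {β : Γ}
    (h : ν f = β) : f ≠ 0 := by
  rw [← ν.ne_top_iff, h]
  exact WithTop.coe_ne_top

theorem DualGraphData.RealizesPiece.kind_zero {ν : AddValuation K (WithTop Γ)}
    (h : d.RealizesPiece ν P 1) (hm : 1 ≤ d.m 1) (ha : 1 ≤ d.a 1 1) :
    blowupKind ν (P 0) = .x := by
  have := h.kind_first hm ha
  rwa [show d.sigma 1 0 0 = 0 by simp [sigma], if_neg (by omega)] at this

/-- If all pieces before the `n`-th one are finite and the `n`-th one is nonempty, the former are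
followed by `z`-blowups. -/
theorem isCompletePiece_of_realizesPiece {ν : AddValuation K (WithTop Γ)}
    (hf : ∀ i, 1 ≤ i → i < n → d.FinitePiece i) (hr : ∀ i, 1 ≤ i → i ≤ n → d.RealizesPiece ν P i)
    (hm : 1 ≤ d.m n) (ha : 1 ≤ d.a n 1) (hn : 1 ≤ n) :
    blowupKind ν (P 0) = .x ∧ ∀ i, 1 ≤ i → i < n → d.IsCompletePiece ν P i := by
  have h1 : ∀ i, 1 ≤ i → i ≤ n → 1 ≤ d.m i ∧ 1 ≤ d.a i 1 := by
    intro i hi hin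
    rcases hin.lt_or_eq with hlt | rfl
    · have := hf i hi hlt
      have h2 : 1 ≤ d.m i := le_trans (by norm_num) this.two_le
      exact ⟨h2, this.one_le 1 le_rfl (by exact_mod_cast h2)⟩
    · exact ⟨hm, ha⟩
  refine ⟨(hr 1 le_rfl hn).kind_zero (h1 1 le_rfl hn).1 (h1 1 le_rfl hn).2, fun i hi hin => ?_⟩
  refine (hf i hi hin).isCompletePiece (hr i hi hin.le) ?_
  have := (hr (i + 1) (by omega) hin).kind_first (h1 (i + 1) (by omega) hin).1
    (h1 (i + 1) (by omega) hin).2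
  rwa [if_pos (by omega)] at this

/-- The value of the last member of a generating sequence, and the recursive formula for the preceding
ones, if the pieces before the `n`-th one are finite. -/
theorem values_of_isCompletePiece [IsScalarTower k R K] [Module ℚ Γ]
    {ν : AddValuation K (WithTop Γ)} (hν : IsCenteredOn R ν)
    (hxy : maximalIdeal R = Ideal.span {x, y})
    (hP : IsBlowupSequence k ν (algebraMap R K x) (algebraMap R K y) P) {g' : ℕ∞}
    (hQ : IsMinimalGeneratingSequence k d ν x y g' Q) {β₀ : Γ} (hβ : ν (algebraMap R K x) = β₀)
    (h0 : blowupKind ν (P 0) = .x) (hn : (n : ℕ∞) ≤ g') (h1n : 1 ≤ n)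
    (hc : ∀ i, 1 ≤ i → i < n → d.IsCompletePiece ν P i)
    (hnon : ∀ m : ℕ, ν (P (d.sigma n 0 1)).2 ≠ m • ν (P (d.sigma n 0 1)).1) :
    (∀ i, 2 ≤ i → i < n → StandardValue d ν Q β₀ i) ∧
    (∃ M, IsAdapted k ν (fun j => algebraMap R K (Q j)) n (d.q (n - 1))
      (P (d.sigma n 0 1)).1 (P (d.sigma n 0 1)).2 M) ∧
    (β₀ : WithTop Γ) = d.qProd (n - 1) • ν (P (d.sigma n 0 1)).1 := by
  obtain ⟨hx', hy'⟩ := hν.pos_of_eq_span hxy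
  have hx := AddValuation.ne_zero_of_map_eq_coe hβ
  refine ⟨fun i hi hin => ?_, exists_isAdapted hν hP hQ hx hx' hy' h0 hn hc hnon h1n, ?_⟩
  · have hci := hc i (by omega) hin
    obtain ⟨M, hA⟩ := exists_isAdapted hν hP hQ hx hx' hy' h0
      (le_trans (by exact_mod_cast hin.le) hn) (fun j h1 h2 => hc j h1 (by omega))
      ((hci.segments.mono (by have := hci.two_le; omega)).snd_ne_nsmul hP hx hx' hy'
        hci.kind_second) (by omega)
    exact standardValue_of_isAdapted hν hP hx' hy' hβ h0 (by omega)
      (fun j h1 h2 => hc j h1 (by omega)) hA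
  · have := map_eq_qProd_nsmul hν hP hx hx' hy' h0 (n - 1) fun j h1 h2 => hc j h1 (by omega)
    rwa [Nat.sub_add_cancel h1n, hβ] at this

/-- Here the n-th piece is itself complete, so its own β' determines ν(Y). -/
theorem standardValue_of_forall_isCompletePiece [IsScalarTower k R K] [Module ℚ Γ]
    {ν : AddValuation K (WithTop Γ)} (hν : IsCenteredOn R ν)
    (hxy : maximalIdeal R = Ideal.span {x, y})
    (hP : IsBlowupSequence k ν (algebraMap R K x) (algebraMap R K y) P) {g' : ℕ∞}
    (hQ : IsMinimalGeneratingSequence k d ν x y g' Q) {β₀ : Γ} (hβ : ν (algebraMap R K x) = β₀)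
    (h0 : blowupKind ν (P 0) = .x) (hn : (n : ℕ∞) ≤ g') (h1n : 1 ≤ n)
    (hc : ∀ i, 1 ≤ i → i ≤ n → d.IsCompletePiece ν P i) : StandardValue d ν Q β₀ n := by
  obtain ⟨hx', hy'⟩ := hν.pos_of_eq_span hxy
  have hx := AddValuation.ne_zero_of_map_eq_coe hβ
  have hcn := hc n h1n le_rfl
  obtain ⟨-, ⟨M, hA⟩, -⟩ := values_of_isCompletePiece hν hxy hP hQ hβ h0 hn h1n
    (fun j h1 h2 => hc j h1 h2.le)
    ((hcn.segments.mono (by have := hcn.two_le; omega)).snd_ne_nsmul hP hx hx' hy' hcn.kind_second)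
  exact standardValue_of_isAdapted hν hP hx' hy' hβ h0 h1n hc hA

theorem standardValue_of_isType1 [IsScalarTower k R K] {ν : AddValuation K (WithTop ℝ)} {β₀ : ℝ}
    (hν : IsCenteredOn R ν) (hxy : maximalIdeal R = Ideal.span {x, y})
    (hP : IsBlowupSequence k ν (algebraMap R K x) (algebraMap R K y) P) (hd : d.IsType1 ν P)
    (hQ : IsMinimalGeneratingSequence k d ν x y ⊤ Q) (hβ : ν (algebraMap R K x) = β₀) {i : ℕ}
    (hi : 2 ≤ i) : StandardValue d ν Q β₀ i := by
  -- The piece i + 1 supplies the z-blowup that completes piece i.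
  have hf := hd.finitePiece (i + 1) (by omega)
  have h2 : 1 ≤ d.m (i + 1) := le_trans (by norm_num) hf.two_le
  obtain ⟨h0, hc⟩ := isCompletePiece_of_realizesPiece (n := i + 1) (fun j h1 _ => hd.finitePiece j h1)
    (fun j h1 _ => hd.realizes j h1) h2 (hf.one_le 1 le_rfl (by exact_mod_cast h2)) (by omega)
  exact standardValue_of_forall_isCompletePiece hν hxy hP hQ hβ h0 le_top (by omega)
    fun j h1 h2 => hc j h1 (by omega)

theorem standardValue_of_isType41 [IsScalarTower k R K] {ν : AddValuation K (WithTop ℝ)} {β₀ : ℝ}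
    (hν : IsCenteredOn R ν) (hxy : maximalIdeal R = Ideal.span {x, y})
    (hP : IsBlowupSequence k ν (algebraMap R K x) (algebraMap R K y) P) (hd : d.IsType41 ν P)
    (hQ : IsMinimalGeneratingSequence k d ν x y d.gNat Q) (hβ : ν (algebraMap R K x) = β₀) {i : ℕ}
    (hi : 2 ≤ i) (hig : i ≤ d.gNat) : StandardValue d ν Q β₀ i := by
  have hf := hd.finitePiece d.gNat (by omega) le_rfl
  have h2 : 1 ≤ d.m d.gNat := le_trans (by norm_num) hf.two_le
  obtain ⟨h0, hc⟩ := isCompletePiece_of_realizesPiece (n := d.gNat)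
    (fun j h1 h2 => hd.finitePiece j h1 h2.le) (fun j h1 h2 => hd.realizes j h1 h2) h2
    (hf.one_le 1 le_rfl (by exact_mod_cast h2)) (by omega)
  refine standardValue_of_forall_isCompletePiece hν hxy hP hQ hβ h0 (by exact_mod_cast hig) (by omega)
    fun j h1 h2 => ?_
  rcases (h2.trans hig).lt_or_eq with hlt | rfl
  · exact hc j h1 hlt
  · exact hf.isCompletePiece (hd.realizes _ h1 le_rfl) (hd.tail_first h1)

/-- After every number of segments, ν(X) and ν(XY) are positive combinations of consecutive
continuants, so the convergents tend to their ratio; it equals 1 + ν(Y)/ν(X), and the normalization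
makes ν(X) = 1/(q_1 ⋯ q_{g-1}). -/
theorem values_of_isType2 [IsDomain R] [IsFractionRing R K] [IsScalarTower k R K] {ν : AddValuation K (WithTop ℝ)}
    (hν : IsCenteredOn R ν) (hxy : maximalIdeal R = Ideal.span {x, y})
    (hP : IsBlowupSequence k ν (algebraMap R K x) (algebraMap R K y) P) (hd : d.IsType2 ν P)
    (hQ : IsMinimalGeneratingSequence k d ν x y d.gNat Q)
    (hβ : ν (algebraMap R K x) = ((1 : ℝ) : WithTop ℝ)) :
    (∀ i, 2 ≤ i → i < d.gNat → StandardValue d ν Q (1 : ℝ) i) ∧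
      ν (algebraMap R K (Q d.gNat)) = d.q (d.gNat - 1) • ν (algebraMap R K (Q (d.gNat - 1)))
        + ν (P (d.sigma d.gNat 0 1)).2 ∧
      ∃ βt : ℝ, Irrational βt ∧
        Filter.Tendsto (fun n => (d.convergent d.gNat n : ℝ)) Filter.atTop (nhds βt) ∧
        ν (P (d.sigma d.gNat 0 1)).2
          = ((1 / (d.qProd (d.gNat - 1) : ℝ) * (βt - 1) : ℝ) : WithTop ℝ) := by
  obtain ⟨hx', hy'⟩ := hν.pos_of_eq_span hxy
  have hx := AddValuation.ne_zero_of_map_eq_coe hβ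
  have hg := hd.one_le_g
  obtain ⟨h0, hc⟩ := isCompletePiece_of_realizesPiece hd.finitePiece hd.realizes
    (by rw [hd.m_g]; exact le_top) (hd.one_le 1 le_rfl) hg
  have hr := hd.realizes d.gNat hg le_rfl
  have hseg : ∀ s, d.RealizesSegments ν P d.gNat s := fun s =>
    hr.realizesSegments (by rw [hd.m_g]; exact le_top) (fun j h1 _ => hd.one_le j h1)
      (fun j h1 _ => hd.a_ne_top j h1)
  obtain ⟨hstd, ⟨M, hA⟩, hprod⟩ := values_of_isCompletePiece hν hxy hP hQ hβ h0 le_rfl hg hc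
    ((hseg 1).snd_ne_nsmul hP hx hx' hy'
      (hr.kind_second (by rw [hd.m_g]; exact le_top) (hd.one_le 2 (by omega))))
  refine ⟨hstd, hA.value_eq, ?_⟩
  have ha1 : ∀ j, j ≠ 0 → 1 ≤ d.entry d.gNat (j + 1) := fun j _ =>
    (hseg (j + 1)).one_le (j + 1) (by omega) le_rfl
  have hXpos := hA.fst_pos
  have hXfin : ν (P (d.sigma d.gNat 0 1)).1 ≠ ⊤ := by rw [Ne, ν.top_iff]; exact hP.fst_ne_zero hx _
  have hYfin : ν (P (d.sigma d.gNat 0 1)).2 ≠ ⊤ := by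
    have := hQ.map_ne_top (i := d.gNat) le_rfl
    have h := hA.value_eq
    intro h'
    rw [h', add_top] at h
    exact this h
  have hval : ∀ r, ∃ α β : ℝ, 0 < α ∧ 0 < β ∧
      ν (P (d.sigma d.gNat 0 1)).1 = ((contDen (fun j => d.entry d.gNat (j + 1)) (r + 1) * α
        + contDen (fun j => d.entry d.gNat (j + 1)) r * β : ℝ) : WithTop ℝ) ∧
      ν (P (d.sigma d.gNat 0 1)).1 + ν (P (d.sigma d.gNat 0 1)).2
        = ((contNum (fun j => d.entry d.gNat (j + 1)) (r + 1) * α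
        + contNum (fun j => d.entry d.gNat (j + 1)) r * β : ℝ) : WithTop ℝ) := by
    intro r
    obtain ⟨hmon1, hmon2⟩ := (hseg (r + 1)).eq_monomial hP
    have hpos := hP.pos hx hx' hy' (d.sigma d.gNat (r + 1) 0)
    have hfin1 : ν (P (d.sigma d.gNat (r + 1) 0)).1 ≠ ⊤ := by
      rw [Ne, ν.top_iff]; exact hP.fst_ne_zero hx _
    -- If this parameter vanished, so would XY for even r and X for odd r, since it occurs there
    -- with a nonzero exponent.
    have hfin2 : ν (P (d.sigma d.gNat (r + 1) 0)).2 ≠ ⊤ := by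
      rw [Ne, ν.top_iff]
      intro h
      have hY : (P (d.sigma d.gNat 0 1)).2 ≠ 0 := by rwa [Ne, ν.top_iff] at hYfin
      have hX := hP.fst_ne_zero hx (d.sigma d.gNat 0 1)
      have hk : contDen (fun j => d.entry d.gNat (j + 1)) (r + 1) ≠ 0 :=
        Nat.one_le_iff_ne_zero.mp (contDen_pos (fun j => d.entry d.gNat (j + 1)) (n := r) fun j h0 _ => ha1 j h0)
      rcases Nat.even_or_odd r with hr | hr
      · have hn : contNum (fun j => d.entry d.gNat (j + 1)) r ≠ 0 := by
          intro h
          have := (cont_det_of_even (fun j => d.entry d.gNat (j + 1)) hr).1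
          rw [h] at this
          omega
        have := (hmon1 hr).2
        rw [h, zero_pow hn, mul_zero] at this
        exact mul_ne_zero hX hY this
      · have := (hmon2 hr).1
        rw [h, zero_pow hk, zero_mul] at this
        exact hX this
    rw [← ν.map_mul]
    rcases Nat.even_or_odd r with hr | hr
    · obtain ⟨e1, e2⟩ := hmon1 hr
      rw [e2, e1, ν.map_mul, ν.map_mul, ν.map_pow, ν.map_pow, ν.map_pow, ν.map_pow]
      generalize ν (P (d.sigma d.gNat (r + 1) 0)).1 = α at *
      generalize ν (P (d.sigma d.gNat (r + 1) 0)).2 = β at *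
      lift α to ℝ using hfin1
      lift β to ℝ using hfin2
      refine ⟨α, β, by exact_mod_cast hpos.1, by exact_mod_cast hpos.2, ?_, ?_⟩ <;>
        simp only [← nsmul_eq_mul, WithTop.coe_add, WithTop.coe_nsmul]
    · obtain ⟨e1, e2⟩ := hmon2 hr
      rw [e2, e1, ν.map_mul, ν.map_mul, ν.map_pow, ν.map_pow, ν.map_pow, ν.map_pow]
      generalize ν (P (d.sigma d.gNat (r + 1) 0)).1 = β at *
      generalize ν (P (d.sigma d.gNat (r + 1) 0)).2 = α at *
      lift α to ℝ using hfin2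
      lift β to ℝ using hfin1
      refine ⟨α, β, by exact_mod_cast hpos.2, by exact_mod_cast hpos.1, ?_, ?_⟩ <;>
        simp only [← nsmul_eq_mul, WithTop.coe_add, WithTop.coe_nsmul]
  generalize ν (P (d.sigma d.gNat 0 1)).1 = ξ at *
  generalize ν (P (d.sigma d.gNat 0 1)).2 = η at *
  lift ξ to ℝ using hXfin
  lift η to ℝ using hYfin
  have hξ : 0 < ξ := by exact_mod_cast hXpos
  obtain ⟨hirr, htend⟩ := irrational_and_tendsto_convergents
    (fun j => d.entry d.gNat (j + 1)) ha1 (ζ := ξ + η) hξ (by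
      intro r
      obtain ⟨α, β, h1, h2, h3, h4⟩ := hval r
      exact ⟨α, β, h1, h2, by exact_mod_cast h3, by exact_mod_cast h4⟩)
  refine ⟨(ξ + η) / ξ, hirr, ?_, ?_⟩
  · rw [← Filter.tendsto_add_atTop_iff_nat 1]
    refine htend.congr fun r => ?_
    rw [convergent_succ_eq (ha1 r)]
    push_cast
    rfl
  · rw [← WithTop.coe_nsmul, WithTop.coe_inj, nsmul_eq_mul] at hprod
    have hq : (d.qProd (d.gNat - 1) : ℝ) ≠ 0 := by
      intro h
      rw [h, zero_mul] at hprod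
      exact one_ne_zero hprod
    rw [WithTop.coe_inj]
    field_simp
    linear_combination -η * hprod

/-- The normalization level is the end of segment m - 1. There the parameter carrying the
continuants of index m - 1 has value (1, 0) and the other one (0, 1), so ν(X) and ν(XY) can be read
off from the exponents. -/
theorem values_of_isType3 [IsScalarTower k R K] {ν : AddValuation K (WithTop (ℚ ×ₗ ℚ))}
    {β₀ : ℚ ×ₗ ℚ} {m n : ℕ} (hν : IsCenteredOn R ν) (hxy : maximalIdeal R = Ideal.span {x, y})
    (hP : IsBlowupSequence k ν (algebraMap R K x) (algebraMap R K y) P) (hd : d.IsType3 ν P)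
    (hQ : IsMinimalGeneratingSequence k d ν x y d.gNat Q) (hβ : ν (algebraMap R K x) = β₀)
    (hm : m = d.numSeg d.gNat) (hn : n = d.sigma d.gNat (m - 2) (d.entry d.gNat (m - 1)))
    (hodd : Odd m → ν (P n).1 = (toLex ((0 : ℚ), (1 : ℚ)) : ℚ ×ₗ ℚ) ∧
      ν (P n).2 = (toLex ((1 : ℚ), (0 : ℚ)) : ℚ ×ₗ ℚ))
    (heven : Even m → ν (P n).1 = (toLex ((1 : ℚ), (0 : ℚ)) : ℚ ×ₗ ℚ) ∧
      ν (P n).2 = (toLex ((0 : ℚ), (1 : ℚ)) : ℚ ×ₗ ℚ)) :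
    (∀ i, 2 ≤ i → i < d.gNat → StandardValue d ν Q β₀ i) ∧
      ν (algebraMap R K (Q d.gNat)) = d.q (d.gNat - 1) • ν (algebraMap R K (Q (d.gNat - 1)))
        + ν (P (d.sigma d.gNat 0 1)).2 ∧
      ν (P (d.sigma d.gNat 0 1)).2
        = (toLex (d.lam d.gNat (m - 1) - d.mu d.gNat (m - 1),
            d.lam d.gNat (m - 2) - d.mu d.gNat (m - 2)) : ℚ ×ₗ ℚ) ∧
      β₀ = d.qProd (d.gNat - 1) • toLex (d.mu d.gNat (m - 1), d.mu d.gNat (m - 2)) := by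
  obtain ⟨hx', hy'⟩ := hν.pos_of_eq_span hxy
  have hx := AddValuation.ne_zero_of_map_eq_coe hβ
  have hg := hd.one_le_g
  have h2m := hd.two_le_m_g
  have hmg : (d.numSeg d.gNat : ℕ∞) = d.m d.gNat := ENat.natCast_toNat hd.m_g_ne_top
  have hmg2 : 2 ≤ d.m d.gNat := by rw [← hmg]; exact_mod_cast h2m
  obtain ⟨h0, hc⟩ := isCompletePiece_of_realizesPiece hd.finitePiece hd.realizes
    (le_trans (by norm_num) hmg2) (hd.one_le 1 le_rfl (by omega)) hg
  have hr := hd.realizes d.gNat hg le_rfl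
  obtain ⟨r, hr2⟩ := Nat.exists_eq_add_of_le' h2m
  rw [hr2] at hm
  subst hm
  have hseg : d.RealizesSegments ν P d.gNat (r + 1) :=
    hr.realizesSegments (by rw [← hmg, hr2]; exact_mod_cast Nat.le_succ _)
      (fun j h1 h2 => hd.one_le j h1 (by omega)) (fun j h1 h2 => hd.a_ne_top j h1 (by omega))
  -- For m = 2 the second segment is the infinite one.
  have ha2 : 1 ≤ d.a d.gNat 2 := by
    rcases Nat.eq_zero_or_pos r with rfl | hpos
    · have := hd.a_last
      rw [hr2, zero_add] at this
      rw [this]; exact le_top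
    · exact hd.one_le 2 (by omega) (by omega)
  obtain ⟨hstd, ⟨M, hA⟩, hprod⟩ := values_of_isCompletePiece hν hxy hP hQ hβ h0 le_rfl hg hc
    ((hseg.mono (by omega)).snd_ne_nsmul hP hx hx' hy' (hr.kind_second hmg2 ha2))
  refine ⟨hstd, hA.value_eq, ?_⟩
  rw [show r + 2 - 2 = r by omega, show r + 2 - 1 = r + 1 by omega, sigma_entry] at hn
  rw [show r + 2 - 2 = r by omega, show r + 2 - 1 = r + 1 by omega]
  obtain ⟨hl1, hm1⟩ := lam_mu_eq (n := r + 1) hseg.one_le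
  obtain ⟨hl0, hm0⟩ := lam_mu_eq (n := r) fun j h1 h2 => hseg.one_le j h1 (by omega)
  rw [hl1, hm1, hl0, hm0]
  obtain ⟨hmon1, hmon2⟩ := hseg.eq_monomial hP
  rw [← hn] at hmon1 hmon2
  generalize contNum (fun j => d.entry d.gNat (j + 1)) (r + 1) = h₁ at *
  generalize contNum (fun j => d.entry d.gNat (j + 1)) r = h₀ at *
  generalize contDen (fun j => d.entry d.gNat (j + 1)) (r + 1) = k₁ at *
  generalize contDen (fun j => d.entry d.gNat (j + 1)) r = k₀ at *
  have hcomb : ∀ a b : ℕ, a • ((toLex ((1 : ℚ), (0 : ℚ)) : ℚ ×ₗ ℚ) : WithTop (ℚ ×ₗ ℚ))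
      + b • ((toLex ((0 : ℚ), (1 : ℚ)) : ℚ ×ₗ ℚ) : WithTop (ℚ ×ₗ ℚ))
      = ((toLex ((a : ℚ), (b : ℚ)) : ℚ ×ₗ ℚ) : WithTop (ℚ ×ₗ ℚ)) := by
    intro a b
    rw [← WithTop.coe_nsmul, ← WithTop.coe_nsmul, ← WithTop.coe_add, WithTop.coe_inj]
    change toLex (a • ((1 : ℚ), (0 : ℚ)) + b • ((0 : ℚ), (1 : ℚ))) = _
    simp
  have hvals : ν (P (d.sigma d.gNat 0 1)).1
        = ((toLex ((k₁ : ℚ), (k₀ : ℚ)) : ℚ ×ₗ ℚ) : WithTop (ℚ ×ₗ ℚ)) ∧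
      ν (P (d.sigma d.gNat 0 1)).1 + ν (P (d.sigma d.gNat 0 1)).2
        = ((toLex ((h₁ : ℚ), (h₀ : ℚ)) : ℚ ×ₗ ℚ) : WithTop (ℚ ×ₗ ℚ)) := by
    rw [← ν.map_mul]
    rcases Nat.even_or_odd r with hr | hr
    · obtain ⟨e1, e2⟩ := hmon1 hr
      obtain ⟨v1, v2⟩ := heven (by grind)
      rw [e2, e1, ν.map_mul, ν.map_mul, ν.map_pow, ν.map_pow, ν.map_pow, ν.map_pow, v1, v2,
        hcomb, hcomb]
      exact ⟨rfl, rfl⟩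
    · obtain ⟨e1, e2⟩ := hmon2 hr
      obtain ⟨v1, v2⟩ := hodd (by grind)
      rw [e2, e1, ν.map_mul, ν.map_mul, ν.map_pow, ν.map_pow, ν.map_pow, ν.map_pow, v1, v2,
        hcomb, hcomb]
      exact ⟨rfl, rfl⟩
  obtain ⟨v1, v2⟩ := hvals
  constructor
  · rw [v1] at v2
    have hfin : ν (P (d.sigma d.gNat 0 1)).2 ≠ ⊤ := by
      intro h
      rw [h, add_top] at v2
      exact WithTop.coe_ne_top v2.symm
    generalize ν (P (d.sigma d.gNat 0 1)).2 = η at *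
    lift η to ℚ ×ₗ ℚ using hfin
    rw [← WithTop.coe_add, WithTop.coe_inj, ← eq_sub_iff_add_eq', ← toLex_sub,
      Prod.mk_sub_mk] at v2
    rw [v2]
  · rw [v1, ← WithTop.coe_nsmul, WithTop.coe_inj] at hprod
    exact hprod

/-- The values of Q_0, …, Q_g are multiples of ν(X), whose first component is 0. Hence all first
components in the value group are multiples of that of ν(Y), say a. As 1 occurs among them, a = ±1,
and positivity of ν(Y) gives a = 1. -/
theorem values_of_isType42 [IsDomain R] [IsFractionRing R K] [IsScalarTower k R K]
    {ν : AddValuation K (WithTop (ℚ ×ₗ ℚ))} (hν : IsCenteredOn R ν)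
    (hxy : maximalIdeal R = Ideal.span {x, y})
    (hP : IsBlowupSequence k ν (algebraMap R K x) (algebraMap R K y) P) (hd : d.IsType42 ν P)
    (hQ : IsMinimalGeneratingSequence k d ν x y (d.gNat + 1 : ℕ) Q)
    (hβ : ν (algebraMap R K x) = (toLex ((0 : ℚ), (1 : ℚ)) : ℚ ×ₗ ℚ))
    (hgroup : ∀ γ : ℚ ×ₗ ℚ, (∃ f : K, ν f = γ) ↔
      ∃ a b : ℤ, γ = toLex ((a : ℚ), (b : ℚ) / (d.qProd d.gNat : ℚ))) :
    (∀ i, 2 ≤ i → i < d.gNat + 1 →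
        StandardValue d ν Q (toLex ((0 : ℚ), (1 : ℚ)) : ℚ ×ₗ ℚ) i) ∧
      ν (algebraMap R K (Q (d.gNat + 1))) = d.q d.gNat • ν (algebraMap R K (Q d.gNat))
        + ν (P (d.sigma (d.gNat + 1) 0 1)).2 ∧
      ∃ n : ℤ, ν (P (d.sigma (d.gNat + 1) 0 1)).2
        = (toLex ((1 : ℚ), (n : ℚ) / (d.qProd d.gNat : ℚ)) : ℚ ×ₗ ℚ) := by
  obtain ⟨hx', hy'⟩ := hν.pos_of_eq_span hxy
  have hx := AddValuation.ne_zero_of_map_eq_coe hβ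
  obtain ⟨h0, hc⟩ := isCompletePiece_of_realizesPiece (n := d.gNat + 1)
    (fun i h1 h2 => hd.finitePiece i h1 (by omega)) hd.realizes hd.m_tail.ge
    (by rw [hd.a_tail]; exact le_top) (by omega)
  have hr := hd.realizes (d.gNat + 1) (by omega) le_rfl
  have hxs : ∀ t, blowupKind ν (P (d.sigma (d.gNat + 1) 0 1 + t)) = .x := by
    intro t
    have := hr 1 le_rfl (by rw [hd.m_tail]; norm_num) (1 + t)
      (by rw [hd.a_tail]; exact ENat.natCast_lt_top _)
    rw [Nat.sub_self, sigma_add] at this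
    rw [this]
    simp [expectedKind]
  obtain ⟨hstd, ⟨M, hA⟩, hprod⟩ := values_of_isCompletePiece hν hxy hP hQ hβ h0 le_rfl (by omega) hc
    (snd_ne_nsmul_of_x hP hx hx' hy' hxs)
  rw [Nat.add_sub_cancel] at hprod
  have hval := hA.value_eq
  refine ⟨hstd, hval, ?_⟩
  rw [← hA.nsmul_eq] at hval
  have hXfin : ν (P (d.sigma (d.gNat + 1) 0 1)).1 ≠ ⊤ := by
    rw [Ne, ν.top_iff]; exact hP.fst_ne_zero hx _
  have hYfin : ν (P (d.sigma (d.gNat + 1) 0 1)).2 ≠ ⊤ := by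
    intro h'
    rw [h', add_top] at hval
    exact hQ.map_ne_top (i := d.gNat + 1) le_rfl hval
  have hYpos := hA.snd_pos
  have hlow : ∀ j < d.gNat + 1, ∃ N : ℕ, ν (algebraMap R K (Q j))
      = N • ν (P (d.sigma (d.gNat + 1) 0 1)).1 := by
    intro j hj
    obtain ⟨N, V, hV, e⟩ := hA.lower j hj
    exact ⟨N, by rw [e, ν.map_mul, ν.map_pow, hV.2, add_zero]⟩
  obtain ⟨γ, hγ⟩ := WithTop.ne_top_iff_exists.mp hYfin
  obtain ⟨a, b, hab⟩ := (hgroup γ).mp ⟨_, hγ.symm⟩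
  rw [hab] at hγ
  obtain ⟨ξ, hξ⟩ := WithTop.ne_top_iff_exists.mp hXfin
  rw [← hξ] at hprod hlow hval
  rw [← hγ] at hval hYpos
  have hξ0 : (ofLex ξ).1 = 0 := by
    rw [← WithTop.coe_nsmul, WithTop.coe_inj] at hprod
    have h1 : (0 : ℚ) = d.qProd d.gNat • (ofLex ξ).1 := congrArg (fun γ => (ofLex γ).1) hprod
    rcases eq_or_ne (d.qProd d.gNat) 0 with h | h
    · rw [h, zero_smul] at hprod
      have h2 : (1 : ℚ) = 0 := congrArg (fun γ => (ofLex γ).2) hprod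
      exact absurd h2 one_ne_zero
    · rw [nsmul_eq_mul, eq_comm, mul_eq_zero] at h1
      exact h1.resolve_left (by exact_mod_cast h)
  have hsmul : ∀ N : ℕ, N • ξ = toLex ((0 : ℚ), N • (ofLex ξ).2) := by
    intro N
    change toLex (N • (ofLex ξ).1, N • (ofLex ξ).2) = _
    rw [hξ0, smul_zero]
  have hsub : valueSemigroup R ν ⊆ firstMultiples (a : ℚ) := by
    rw [hQ.generates, SetLike.coe_subset_coe, AddSubsemigroup.closure_le]
    rintro _ ⟨j, hj, rfl⟩
    rcases (show j ≤ d.gNat + 1 by exact_mod_cast hj).lt_or_eq with hlt | rfl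
    · obtain ⟨N, e⟩ := hlow j hlt
      exact ⟨0, N • (ofLex ξ).2, by rw [e, ← WithTop.coe_nsmul, hsmul, Int.cast_zero, zero_mul]⟩
    · refine ⟨1, M • (ofLex ξ).2 + b / d.qProd d.gNat, ?_⟩
      rw [hval, ← WithTop.coe_nsmul, hsmul, ← WithTop.coe_add, ← toLex_add, Prod.mk_add_mk, zero_add,
        Int.cast_one, one_mul]
  obtain ⟨f, hf⟩ := (hgroup (toLex ((1 : ℚ), 0))).mpr ⟨1, 0, by simp⟩
  obtain ⟨c, r, hcr⟩ := map_mem_firstMultiples hν hsub (AddValuation.ne_zero_of_map_eq_coe hf)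
  rw [hf, WithTop.coe_inj] at hcr
  have hca : (1 : ℚ) = c * a := congrArg (fun γ => (ofLex γ).1) hcr
  have hca' : c * a = 1 := by exact_mod_cast hca.symm
  have ha0 : 0 ≤ a := by
    by_contra hneg
    have h1 : (toLex ((a : ℚ), (b : ℚ) / (d.qProd d.gNat : ℚ)) : ℚ ×ₗ ℚ) < 0 := by
      rw [Prod.Lex.lt_iff]
      left
      change (a : ℚ) < 0
      exact_mod_cast not_le.mp hneg
    have h2 : (0 : ℚ ×ₗ ℚ) < toLex ((a : ℚ), (b : ℚ) / (d.qProd d.gNat : ℚ)) := by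
      exact_mod_cast hYpos
    exact lt_asymm h1 h2
  have ha1 : a = 1 := by
    rcases Int.eq_one_or_neg_one_of_mul_eq_one (by rwa [mul_comm] at hca') with h | h
    · exact h
    · omega
  exact ⟨b, by rw [← hγ, ha1, Int.cast_one]⟩

end Types

theorem lemma4 {k R K : Type*} [Field k] [IsAlgClosed k] [CharZero k]
    [CommRing R] [IsDomain R] [IsRegularLocalRing R] [Field K]
    [Algebra k R] [Algebra R K] [Algebra k K] [IsScalarTower k R K] [IsFractionRing R K]
    [Algebra.EssFiniteType k K] (htr : Algebra.trdeg k K = 2) (hdim : ringKrullDim R = 2)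
    (x y : R) (hxy : IsLocalRing.maximalIdeal R = Ideal.span {x, y})
    (d : DualGraphData) (P : ℕ → K × K) (Q : ℕ → R) :
    -- Type 1 (`g' = ∞`)
    (∀ (ν : AddValuation K (WithTop ℝ)) (β₀ : ℝ), IsCenteredOn R ν →
      IsBlowupSequence k ν (algebraMap R K x) (algebraMap R K y) P →
      d.IsType1 ν P → IsMinimalGeneratingSequence k d ν x y ⊤ Q → ν (algebraMap R K x) = β₀ →
      ∀ i, 2 ≤ i → StandardValue d ν Q β₀ i) ∧
    -- Type 4.1 (`g' = g`)
    (∀ (ν : AddValuation K (WithTop ℝ)) (β₀ : ℝ), IsCenteredOn R ν →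
      IsBlowupSequence k ν (algebraMap R K x) (algebraMap R K y) P →
      d.IsType41 ν P → IsMinimalGeneratingSequence k d ν x y d.gNat Q → ν (algebraMap R K x) = β₀ →
      ∀ i, 2 ≤ i → i ≤ d.gNat → StandardValue d ν Q β₀ i) ∧
    -- Type 2 (`g' = g`), normalized by `β₀ = 1`
    (∀ ν : AddValuation K (WithTop ℝ), IsCenteredOn R ν →
      IsBlowupSequence k ν (algebraMap R K x) (algebraMap R K y) P →
      d.IsType2 ν P → IsMinimalGeneratingSequence k d ν x y d.gNat Q →
      ν (algebraMap R K x) = ((1 : ℝ) : WithTop ℝ) →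
      (∀ i, 2 ≤ i → i < d.gNat → StandardValue d ν Q (1 : ℝ) i) ∧
      ν (algebraMap R K (Q d.gNat)) = d.q (d.gNat - 1) • ν (algebraMap R K (Q (d.gNat - 1)))
        + ν (P (d.sigma d.gNat 0 1)).2 ∧
      ∃ βt : ℝ, Irrational βt ∧
        Filter.Tendsto (fun n => (d.convergent d.gNat n : ℝ)) Filter.atTop (nhds βt) ∧
        ν (P (d.sigma d.gNat 0 1)).2
          = ((1 / (d.qProd (d.gNat - 1) : ℝ) * (βt - 1) : ℝ) : WithTop ℝ)) ∧
    -- Type 3 (`g' = g`), normalized at level `Σ(g, m_g - 2, a_{m_g - 1})`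
    (∀ (ν : AddValuation K (WithTop (ℚ ×ₗ ℚ))) (β₀ : ℚ ×ₗ ℚ) (m n : ℕ), IsCenteredOn R ν →
      IsBlowupSequence k ν (algebraMap R K x) (algebraMap R K y) P →
      d.IsType3 ν P → IsMinimalGeneratingSequence k d ν x y d.gNat Q → ν (algebraMap R K x) = β₀ →
      m = d.numSeg d.gNat → n = d.sigma d.gNat (m - 2) (d.entry d.gNat (m - 1)) →
      (Odd m → ν (P n).1 = (toLex ((0 : ℚ), (1 : ℚ)) : ℚ ×ₗ ℚ) ∧
        ν (P n).2 = (toLex ((1 : ℚ), (0 : ℚ)) : ℚ ×ₗ ℚ)) →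
      (Even m → ν (P n).1 = (toLex ((1 : ℚ), (0 : ℚ)) : ℚ ×ₗ ℚ) ∧
        ν (P n).2 = (toLex ((0 : ℚ), (1 : ℚ)) : ℚ ×ₗ ℚ)) →
      (∀ i, 2 ≤ i → i < d.gNat → StandardValue d ν Q β₀ i) ∧
      ν (algebraMap R K (Q d.gNat)) = d.q (d.gNat - 1) • ν (algebraMap R K (Q (d.gNat - 1)))
        + ν (P (d.sigma d.gNat 0 1)).2 ∧
      ν (P (d.sigma d.gNat 0 1)).2
        = (toLex (d.lam d.gNat (m - 1) - d.mu d.gNat (m - 1),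
            d.lam d.gNat (m - 2) - d.mu d.gNat (m - 2)) : ℚ ×ₗ ℚ) ∧
      β₀ = d.qProd (d.gNat - 1) • toLex (d.mu d.gNat (m - 1), d.mu d.gNat (m - 2))) ∧
    -- Type 4.2 (`g' = g + 1`), normalized by `β₀ = (0, 1)` and value group `ℤ × (1/(q_1 ⋯ q_g)) ℤ`
    (∀ ν : AddValuation K (WithTop (ℚ ×ₗ ℚ)), IsCenteredOn R ν →
      IsBlowupSequence k ν (algebraMap R K x) (algebraMap R K y) P →
      d.IsType42 ν P → IsMinimalGeneratingSequence k d ν x y (d.gNat + 1 : ℕ) Q →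
      ν (algebraMap R K x) = (toLex ((0 : ℚ), (1 : ℚ)) : ℚ ×ₗ ℚ) →
      (∀ γ : ℚ ×ₗ ℚ, (∃ f : K, ν f = γ) ↔
        ∃ a b : ℤ, γ = toLex ((a : ℚ), (b : ℚ) / (d.qProd d.gNat : ℚ))) →
      (∀ i, 2 ≤ i → i < d.gNat + 1 →
        StandardValue d ν Q (toLex ((0 : ℚ), (1 : ℚ)) : ℚ ×ₗ ℚ) i) ∧
      ν (algebraMap R K (Q (d.gNat + 1))) = d.q d.gNat • ν (algebraMap R K (Q d.gNat))
        + ν (P (d.sigma (d.gNat + 1) 0 1)).2 ∧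
      ∃ n : ℤ, ν (P (d.sigma (d.gNat + 1) 0 1)).2
        = (toLex ((1 : ℚ), (n : ℚ) / (d.qProd d.gNat : ℚ)) : ℚ ×ₗ ℚ)) := by
  refine ⟨fun ν β₀ hν hP hd hQ hβ i hi => standardValue_of_isType1 hν hxy hP hd hQ hβ hi,
    fun ν β₀ hν hP hd hQ hβ i hi hig => standardValue_of_isType41 hν hxy hP hd hQ hβ hi hig,
    fun ν hν hP hd hQ hβ => values_of_isType2 hν hxy hP hd hQ hβ,
    fun ν β₀ m n hν hP hd hQ hβ hm hn hodd heven =>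
      values_of_isType3 hν hxy hP hd hQ hβ hm hn hodd heven,
    fun ν hν hP hd hQ hβ hgroup => values_of_isType42 hν hxy hP hd hQ hβ hgroup⟩
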